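/- Let $\kappa,\theta>0$, $0<t_1<t_2$, and let $Y$ be the one-dimensional Ornstein--Uhlenbeck process $$dY_t=-\kappa\theta Y_t\,dt+\sqrt{2\kappa}\,dW_t,\qquad Y_0=0,$$ with $W$ a standard Brownian motion. For $t>0$ let $f(t,\cdot\mid x)$ be the probability density of the position at time $t$ of the solution of the same equation started at $x$. The stochastic entropy production over $[t_1,t_2]$ is $$\Delta s=\ln\frac{f(t_1,Y_{t_1}\mid 0)\,f(t_2-t_1,Y_{t_2}\mid Y_{t_1})}{f(t_2,Y_{t_2}\mid 0)\,f(t_2-t_1,Y_{t_1}\mid Y_{t_2})}.$$ Put $q_i=e^{-2\kappa\theta t_i}$ and $$a=-\frac{1-q_2}{2q_2},\qquad b=\left(\frac{1-q_2}{q_2(q_1-q_2)}+\Big(\frac{1-q_2}{2q_2}\Big)^2\right)^{1/2},\qquad s^*=\tfrac12\ln\frac{1-q_2}{1-q_1}.$$ Let $K_0(x)=\int_0^\infty e^{-x\cosh t}\,dt$ ($x>0$) be the modified Bessel function of the second kind of order $0$. Then: 1. $0\le|a|<b$, and $\Delta s$ has the density $$p(x)=\pi^{-1}(b^2-a^2)^{1/2}e^{a(x-s^*)}K_0(b|x-s^*|),\qquad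 x\in\mathbb R .$$ 2. The mean is $\mathbb E[\Delta s]=\frac12\left(\ln\frac{1-q_2}{1-q_1}+(q_2-q_1)\right)>0$, and the variance is $$\mathbb V[\Delta s]=\frac{(q_1-q_2)(q_1+q_2-q_1q_2+q_2^2)}{2(1-q_2)}.$$ 3. $p$ has a logarithmic singularity at $s^*$: $p(x)\sim -c\ln|x-s^*|$ as $x\to s^*$, for a constant $c>0$. 4. $\mathbb P(\Delta s\gtrless s^*)=\dfrac{\arccos(\mp a/b)}{\pi}$. 5. $\mathbb E[\Delta s\mid\Delta s\gtrless s^*]=s^*+\dfrac{a}{b^2-a^2}\pm\dfrac{1}{\sqrt{b^2-a^2}\,\arccos(\mp a/b)}$. 6. There are real numbers $\lambda_-<0<\lambda_+$ such that, for all real $\lambda$, $$1+(q_1-q_2)\lambda-\frac{q_2(q_1-q_2)}{1-q_2}\lambda^2=\Big(1-\frac{\lambda}{\lambda_+}\Big)\Big(1-\frac{\lambda}{\lambda_-}\Big);$$ they satisfy $a=-\frac{\lambda_++\lambda_-}2$ and $b=\frac{\lambda_+-\lambda_-}2$, and for some constants $C_\pm>0$ $$p(x)\sim C_\pm\,|x|^{-1/2}e^{-\lambda_\pm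 x},\qquad x\to\pm\infty .$$ 7. There are independent random variables $\Xi_1,\Xi_2$, each distributed as $\chi^2_1$, and weights $w_1,w_2>0$ such that $\Delta s=s^*+w_1\Xi_1-w_2\Xi_2$ almost surely. -/

import Mathlib

open MeasureTheory ProbabilityTheory Filter Topology Asymptotics
open scoped NNReal

noncomputable section

/-- `Y` solves the Ornstein–Uhlenbeck equation `dY = κ A(Y) dt + √(2κ) dW`, with force field
`A(y) = -θ y` and start `Y₀ = y₀`, on the probability space `(Ω, P)`, driven by `W`.
The noise is additive, so the equation is the pathwise integral equation
`Y t = y₀ + ∫₀ᵗ κ A(Y s) ds + √(2κ) W t`. -/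
structure IsOUProcess {Ω : Type*} [MeasurableSpace Ω] (κ θ y₀ : ℝ) (W Y : ℝ≥0 → Ω → ℝ)
    (P : Measure Ω) : Prop where
  cont : ∀ᵐ ω ∂P, Continuous fun t => Y t ω
  eqn : ∀ᵐ ω ∂P, ∀ t : ℝ≥0,
    Y t ω = y₀ + (∫ s in (0 : ℝ)..t, κ * (-θ * Y s.toNNReal ω)) + √(2 * κ) * W t ω

/-- For a family `Y` of processes indexed by their starting points, `transitionDensity Y P t x y`
is the probability density `f(t, y | x) = 𝒯(x → y, t)` at `y` of the position at time `t` of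
the process started at `x`: the derivative at `y` of the distribution function. -/
def transitionDensity {Ω : Type*} [MeasurableSpace Ω] (Y : ℝ → ℝ≥0 → Ω → ℝ) (P : Measure Ω)
    (t : ℝ≥0) (x y : ℝ) : ℝ :=
  deriv (fun z => cdf (P.map (Y x t)) z) y

/-- The stochastic entropy production of the transition from `x₁` at time `t₁` to `x₂` at time
`t₂`, for the process started at `y₀` at time `0`, where `f t x y` is the density at `y` at time
`t` of the process started at `x`. -/
def entropyProduction (f : ℝ≥0 → ℝ → ℝ → ℝ) (y₀ : ℝ) (t₁ t₂ : ℝ≥0) (x₁ x₂ : ℝ) : ℝ :=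
  Real.log ((f t₁ y₀ x₁ * f (t₂ - t₁) x₁ x₂) / (f t₂ y₀ x₂ * f (t₂ - t₁) x₂ x₁))

/-- The modified Bessel function of the second kind `K_ν(x)`, for `x > 0`. -/
def besselK (ν x : ℝ) : ℝ :=
  ∫ t in Set.Ioi (0 : ℝ), Real.exp (-x * Real.cosh t) * Real.cosh (ν * t)

/-- The (central) chi-squared distribution with one degree of freedom: the law of the square of
a standard normal variable. -/
def chiSquaredOne : Measure ℝ := (gaussianReal 0 1).map fun z => z ^ 2

end

/-! ### Riemann–Stieltjes sums -/

/-! Up to a constant, the entropy production is an indefinite quadratic form in two independent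
standard normals, and everything follows from its two eigenvalues `w₁` and `-w₂`.

Variation of constants writes the process through the Wiener integral of `e^{cs}`, `c = κθ`, defined
by integration by parts. As a limit of Riemann–Stieltjes sums it is Gaussian, and its increment
after `t₁` is independent of its value at `t₁` (`hasLaw_expWiener`, `indepFun_expWiener_shift`).
Hence the transition densities are Gaussian. In the log ratio the mixed term cancels by
reversibility (`log_transition_ratio`), leaving `s*` plus a quadratic form whose matrix has trace
`(q₂ - q₁)/2` and negative determinant. A rotation, which preserves the standard Gaussian, turns
this into `w₁ H₁² - w₂ H₂²` with `w₁ = 1/(2(b - a))`, `w₂ = 1/(2(b + a))`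
(`exists_normals_entropyProduction`). This is the chi-squared representation; mean and variance are
read off from `w₁ - w₂` and `w₁ w₂`.

For the density, integrate the planar Gaussian along the hyperbolas on which the form is constant:
in hyperbolic coordinates the Jacobian is constant and the angular integral is `K₀`
(`lintegral_indicator_Ioi_quadratic`). The singularity and the tails come from `K₀` near `0` and, by
Laplace's method, at infinity. Probabilities and conditional means on each side of `s*` reduce by
Tonelli to integrals of powers of `(b cosh t - a)⁻¹`, which have explicit antiderivatives
(`lintegral_pow_mul_besselDensity`). -/

theorem tendsto_sum_mul_sub_integral {g F F' : ℝ → ℝ} (hg : Continuous g)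
    (hF : ∀ x, HasDerivAt F (F' x) x) (hF' : Continuous F') {t : ℝ} (ht : 0 ≤ t)
    (ξ : ℕ → ℕ → ℝ) (hξ : ∀ n i : ℕ, ξ n i ∈ Set.Icc (t * i / n) (t * (i + 1 : ℕ) / n)) :
    Tendsto (fun n : ℕ => ∑ i ∈ Finset.range n,
      g (ξ n i) * (F (t * (i + 1 : ℕ) / n) - F (t * i / n))) atTop
      (𝓝 (∫ s in (0 : ℝ)..t, g s * F' s)) := by
  obtain ⟨M, hM⟩ := isCompact_Icc.exists_bound_of_continuousOn (s := Set.Icc 0 t) hF'.continuousOn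
  have hM0 : 0 ≤ M := (norm_nonneg _).trans (hM 0 ⟨le_rfl, ht⟩)
  have huc := isCompact_Icc.uniformContinuousOn_of_continuous (s := Set.Icc 0 t) hg.continuousOn
  rw [Metric.uniformContinuousOn_iff] at huc
  rw [Metric.tendsto_atTop]
  intro ε hε
  -- The integrator has variation at most `M t`, so this tolerance gives total error `ε M t / (M t +
  -- 1) < ε`; the `+ 1` covers `M t = 0`.
  obtain ⟨δ, hδ, H⟩ := huc (ε / (M * t + 1)) (by positivity)
  obtain ⟨N, hN⟩ := exists_nat_gt (t / δ)
  refine ⟨max N 1, fun n hn => ?_⟩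
  have hn1 : 1 ≤ n := le_of_max_le_right hn
  have hn0 : (0 : ℝ) < n := by exact_mod_cast hn1
  have hnδ : t / n < δ := by
    rw [div_lt_comm₀ hn0 hδ]
    exact hN.trans_le (by exact_mod_cast le_of_max_le_left hn)
  have hint (a b : ℝ) : IntervalIntegrable (fun s => g s * F' s) volume a b :=
    (hg.mul hF').intervalIntegrable _ _
  have hsplit : ∫ s in (0 : ℝ)..t, g s * F' s =
      ∑ i ∈ Finset.range n, ∫ s in (t * i / n)..(t * (i + 1 : ℕ) / n), g s * F' s := by
    have := intervalIntegral.sum_integral_adjacent_intervals (μ := volume)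
      (f := fun s => g s * F' s) (a := fun i : ℕ => t * i / n) (n := n) (fun k _ => hint _ _)
    rw [this]
    congr 1
    · simp
    · field_simp
  have hterm : ∀ i ∈ Finset.range n,
      |g (ξ n i) * (F (t * (i + 1 : ℕ) / n) - F (t * i / n)) -
        ∫ s in (t * i / n)..(t * (i + 1 : ℕ) / n), g s * F' s| ≤
        ε / (M * t + 1) * M * (t / n) := by
    intro i hi
    have hin : ((i + 1 : ℕ) : ℝ) ≤ n := by exact_mod_cast Finset.mem_range.1 hi
    have h1 : F (t * (i + 1 : ℕ) / n) - F (t * i / n) =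
        ∫ s in (t * i / n)..(t * (i + 1 : ℕ) / n), F' s :=
      (intervalIntegral.integral_eq_sub_of_hasDerivAt (fun x _ => hF x)
        (hF'.intervalIntegrable _ _)).symm
    have h2 : IntervalIntegrable (fun s => g (ξ n i) * F' s) volume (t * i / n)
        (t * (i + 1 : ℕ) / n) := (continuous_const.mul hF').intervalIntegrable _ _
    rw [h1, ← intervalIntegral.integral_const_mul, ← intervalIntegral.integral_sub h2 (hint _ _)]
    have hle : t * i / n ≤ t * (i + 1 : ℕ) / n := by push_cast; gcongr; linarith
    have hlen : t * (i + 1 : ℕ) / n - t * i / n = t / n := by push_cast; ring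
    have h0 : 0 ≤ t * i / n := by positivity
    have hT : t * (i + 1 : ℕ) / n ≤ t := by
      rw [div_le_iff₀ hn0]
      exact mul_le_mul_of_nonneg_left hin ht
    have := intervalIntegral.norm_integral_le_of_norm_le_const (a := t * i / n)
      (b := t * (i + 1 : ℕ) / n) (f := fun s => g (ξ n i) * F' s - g s * F' s)
      (C := ε / (M * t + 1) * M) (fun s hs => ?_)
    · rwa [hlen, abs_of_nonneg (by positivity : 0 ≤ t / n)] at this
    · rw [Set.uIoc_of_le hle] at hs
      have hs' : s ∈ Set.Icc 0 t := ⟨h0.trans hs.1.le, hs.2.trans hT⟩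
      have hξ' : ξ n i ∈ Set.Icc 0 t := ⟨h0.trans (hξ n i).1, (hξ n i).2.trans hT⟩
      have hd : dist (ξ n i) s < δ := by
        rw [Real.dist_eq, abs_lt]
        have := (hξ n i).1
        have := (hξ n i).2
        constructor <;> linarith [hs.1, hs.2]
      have hg' := (H _ hξ' _ hs' hd).le
      rw [Real.dist_eq] at hg'
      rw [← sub_mul, norm_mul]
      exact mul_le_mul hg' (hM s hs') (norm_nonneg _) (by positivity)
  rw [hsplit, Real.dist_eq, ← Finset.sum_sub_distrib]
  calc _ ≤ ∑ i ∈ Finset.range n, ε / (M * t + 1) * M * (t / n) :=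
        (Finset.abs_sum_le_sum_abs _ _).trans (Finset.sum_le_sum hterm)
    _ = ε * (M * t / (M * t + 1)) := by
        rw [Finset.sum_const, Finset.card_range, nsmul_eq_mul]
        field_simp
    _ < ε * 1 := by
        apply mul_lt_mul_of_pos_left _ hε
        rw [div_lt_one (by positivity)]
        linarith
    _ = ε := mul_one ε

/-! ### The Wiener integral of an exponential -/

/-- The pathwise Wiener integral `∫₀ᵗ e^{cs} dw(s)`, defined by integration by parts. -/
noncomputable def expWiener (c : ℝ) (w : ℝ≥0 → ℝ) (t : ℝ≥0) : ℝ :=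
  Real.exp (c * t) * w t - w 0 - ∫ s in (0 : ℝ)..t, w s.toNNReal * (c * Real.exp (c * s))

/-- The Riemann–Stieltjes sums, with right tags, of `∫₀ᵗ e^{cs} dw(s)`. -/
noncomputable def expWienerSum (c : ℝ) (t : ℝ≥0) (n : ℕ) (w : ℝ≥0 → ℝ) : ℝ :=
  ∑ i ∈ Finset.range n, Real.exp (c * (t * (i + 1 : ℕ) / n : ℝ≥0)) *
    (w (t * (i + 1 : ℕ) / n) - w (t * i / n))

theorem hasDerivAt_exp_mul (c x : ℝ) :
    HasDerivAt (fun s => Real.exp (c * s)) (c * Real.exp (c * x)) x := by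
  simpa [mul_comm] using ((hasDerivAt_id x).const_mul c).exp

/-- Summation by parts moves the differences from the rough path to the smooth exponential; right
tags become left tags. Continuity of `w` then suffices, without bounded variation. -/
theorem tendsto_expWienerSum (c : ℝ) {w : ℝ≥0 → ℝ} (hw : Continuous w) (t : ℝ≥0) :
    Tendsto (fun n => expWienerSum c t n w) atTop (𝓝 (expWiener c w t)) := by
  have h := tendsto_sum_mul_sub_integral (g := fun s => w s.toNNReal)
    (F := fun s => Real.exp (c * s)) (F' := fun s => c * Real.exp (c * s))
    (hw.comp continuous_real_toNNReal) (hasDerivAt_exp_mul c) (by fun_prop) t.coe_nonneg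
    (fun n i => t * i / n) (fun n i => ⟨le_rfl, by push_cast; gcongr; linarith⟩)
  have h' := h.const_sub (Real.exp (c * t) * w t - w 0)
  refine h'.congr' ?_
  filter_upwards [eventually_ge_atTop 1] with n hn
  have hn0 : (n : ℝ≥0) ≠ 0 := by exact_mod_cast (by lia : n ≠ 0)
  have hAbel : ∀ m : ℕ, ∑ i ∈ Finset.range m, Real.exp (c * (t * (i + 1 : ℕ) / n : ℝ≥0)) *
      (w (t * (i + 1 : ℕ) / n) - w (t * i / n)) =
      Real.exp (c * (t * m / n : ℝ≥0)) * w (t * m / n) - w 0 -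
      ∑ i ∈ Finset.range m, w (t * i / n) * (Real.exp (c * (t * (i + 1 : ℕ) / n : ℝ≥0)) -
        Real.exp (c * (t * i / n : ℝ≥0))) := by
    intro m
    induction m with
    | zero => simp
    | succ m ih => rw [Finset.sum_range_succ, ih, Finset.sum_range_succ]; ring
  rw [expWienerSum, hAbel n, mul_div_assoc, div_self hn0, mul_one]
  congr 1
  refine Finset.sum_congr rfl fun i _ => ?_
  have : ((t : ℝ) * i / n).toNNReal = t * i / n := by
    rw [← Real.toNNReal_coe (r := t * i / n)]; push_cast; rfl
  rw [this]
  push_cast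
  rfl

section Wiener

variable {Ω : Type*} [MeasurableSpace Ω] {P : Measure Ω}

/-- Dominated convergence for exponentials of modulus one. Through it both normality and
independence pass from the approximating sums to the Wiener integrals. -/
theorem tendsto_charFun_map {E : Type*} [NormedAddCommGroup E] [InnerProductSpace ℝ E]
    [MeasurableSpace E] [BorelSpace E] [SecondCountableTopology E] [IsProbabilityMeasure P]
    {X : ℕ → Ω → E} {Y : Ω → E} (hX : ∀ n, AEMeasurable (X n) P) (hY : AEMeasurable Y P)
    (h : ∀ᵐ ω ∂P, Tendsto (fun n => X n ω) atTop (𝓝 (Y ω))) (ξ : E) :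
    Tendsto (fun n => charFun (P.map (X n)) ξ) atTop (𝓝 (charFun (P.map Y) ξ)) := by
  have hc : Continuous fun x : E => Complex.exp (inner ℝ x ξ * Complex.I) := by fun_prop
  simp_rw [charFun_apply]
  rw [integral_map hY hc.aestronglyMeasurable]
  simp_rw [fun n => integral_map (hX n) hc.aestronglyMeasurable]
  refine tendsto_integral_of_dominated_convergence (fun _ => 1)
    (fun n => (hc.measurable.comp_aemeasurable (hX n)).aestronglyMeasurable)
    (integrable_const _) (fun n => ae_of_all _ fun ω => ?_) ?_
  · rw [Complex.norm_exp_ofReal_mul_I]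
  · filter_upwards [h] with ω hω
    exact (hc.tendsto _).comp hω

theorem indepFun_of_tendsto [IsProbabilityMeasure P] {X Y : ℕ → Ω → ℝ} {X' Y' : Ω → ℝ}
    (hX : ∀ n, AEMeasurable (X n) P) (hY : ∀ n, AEMeasurable (Y n) P)
    (hX' : ∀ᵐ ω ∂P, Tendsto (fun n => X n ω) atTop (𝓝 (X' ω)))
    (hY' : ∀ᵐ ω ∂P, Tendsto (fun n => Y n ω) atTop (𝓝 (Y' ω)))
    (h : ∀ n, IndepFun (X n) (Y n) P) : IndepFun X' Y' P := by
  have mX' := aemeasurable_of_tendsto_metrizable_ae atTop hX hX'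
  have mY' := aemeasurable_of_tendsto_metrizable_ae atTop hY hY'
  rw [indepFun_iff_charFun_prod mX' mY']
  intro ξ
  have h1 := tendsto_charFun_map (P := P) (X := fun n ω => WithLp.toLp 2 (X n ω, Y n ω))
    (Y := fun ω => WithLp.toLp 2 (X' ω, Y' ω))
    (fun n => (WithLp.measurable_toLp 2 _).comp_aemeasurable ((hX n).prodMk (hY n)))
    ((WithLp.measurable_toLp 2 _).comp_aemeasurable (mX'.prodMk mY')) (by
      filter_upwards [hX', hY'] with ω h1 h2
      exact ((WithLp.prod_continuous_toLp 2 ℝ ℝ).tendsto _).comp (h1.prodMk_nhds h2)) ξ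
  have h2 := (tendsto_charFun_map hX mX' hX' ξ.ofLp.1).mul
    (tendsto_charFun_map hY mY' hY' ξ.ofLp.2)
  refine tendsto_nhds_unique h1 (h2.congr fun n => ?_)
  exact ((indepFun_iff_charFun_prod (hX n) (hY n)).1 (h n) ξ).symm

theorem hasLaw_gaussianReal_of_tendsto [IsProbabilityMeasure P] {X : ℕ → Ω → ℝ} {Y : Ω → ℝ}
    {v : ℕ → ℝ≥0} {v' : ℝ≥0} (hX : ∀ n, HasLaw (X n) (gaussianReal 0 (v n)) P)
    (hY : ∀ᵐ ω ∂P, Tendsto (fun n => X n ω) atTop (𝓝 (Y ω)))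
    (hv : Tendsto (fun n => (v n : ℝ)) atTop (𝓝 v')) : HasLaw Y (gaussianReal 0 v') P := by
  have mY := aemeasurable_of_tendsto_metrizable_ae atTop (fun n => (hX n).aemeasurable) hY
  refine ⟨mY, ?_⟩
  have := Measure.isProbabilityMeasure_map mY
  refine Measure.ext_of_charFun (funext fun ξ => ?_)
  refine tendsto_nhds_unique (tendsto_charFun_map (fun n => (hX n).aemeasurable) mY hY ξ) ?_
  simp_rw [fun n => (hX n).map_eq, charFun_gaussianReal]
  have : Tendsto (fun n => ((v n : ℝ) : ℂ)) atTop (𝓝 ((v' : ℝ) : ℂ)) :=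
    (Complex.continuous_ofReal.tendsto _).comp hv
  refine (Complex.continuous_exp.tendsto _).comp ?_
  exact tendsto_const_nhds.sub ((this.mul_const _).div_const _)

variable {W : ℝ≥0 → Ω → ℝ}

/-- Brownian increments over disjoint intervals are independent Gaussians, so their variances add,
each weighted by a squared coefficient. The resulting variance is itself a right-tagged Riemann sum,
for the integral of `e^{2cs}`. -/
theorem hasLaw_expWienerSum [IsProbabilityMeasure P] (hW : IsPreBrownianReal W P) (c : ℝ)
    (t : ℝ≥0) (n : ℕ) :
    HasLaw (fun ω => expWienerSum c t n (W · ω)) (gaussianReal 0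
      (∑ i ∈ Finset.range n, Real.exp (2 * c * (t * (i + 1 : ℕ) / n : ℝ≥0)) *
        ((t * (i + 1 : ℕ) / n : ℝ≥0) - (t * i / n : ℝ≥0))).toNNReal) P := by
  set τ : ℕ → ℝ≥0 := fun i => t * i / n
  have hτ : Monotone τ := fun i j hij => by dsimp only [τ]; gcongr
  have hind := hW.hasIndepIncrements.nat hτ
  have hlaw (i : ℕ) : HasLaw (fun ω => Real.exp (c * τ (i + 1)) * (W (τ (i + 1)) ω - W (τ i) ω))
      (gaussianReal 0 (NNReal.mk (Real.exp (c * τ (i + 1)) ^ 2) (sq_nonneg _) *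
        nndist (τ (i + 1)).1 (τ i).1)) P := by
    simpa using gaussianReal_const_mul (hW.hasLaw_sub (τ (i + 1)) (τ i)) (Real.exp (c * τ (i + 1)))
  have hind' : iIndepFun (fun (i : ℕ) ω => Real.exp (c * τ (i + 1)) *
      (W (τ (i + 1)) ω - W (τ i) ω)) P :=
    hind.comp (fun i x => Real.exp (c * τ (i + 1)) * x) (fun i => by fun_prop)
  have hG := iIndepFun.hasGaussianLaw_fun_sum (fun i : Fin n => (hlaw i).hasGaussianLaw)
    (hind'.precomp (g := (Fin.val : Fin n → ℕ)) Fin.val_injective)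
  have hsum : (fun ω => expWienerSum c t n (W · ω)) =
      fun ω => ∑ i : Fin n, Real.exp (c * τ (i + 1)) * (W (τ (i + 1)) ω - W (τ i) ω) := by
    ext ω
    rw [expWienerSum, Finset.sum_range]
  have hvar (i : ℕ) : Var[fun ω => Real.exp (c * τ (i + 1)) * (W (τ (i + 1)) ω - W (τ i) ω); P] =
      Real.exp (2 * c * τ (i + 1)) * (τ (i + 1) - τ i) := by
    rw [(hlaw i).variance_eq, variance_id_gaussianReal]
    push_cast
    rw [← Real.exp_nat_mul, Real.dist_eq, abs_of_nonneg]
    · rw [NNReal.val_eq_coe, NNReal.val_eq_coe]; push_cast; ring_nf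
    · exact sub_nonneg.2 (hτ (Nat.le_succ i))
  refine ⟨?_, ?_⟩
  · rw [hsum]; exact hG.aemeasurable
  · rw [hsum, hG.map_eq_gaussianReal]
    congr 1
    · rw [integral_finsetSum _ fun (i : Fin n) _ => (hlaw i).hasGaussianLaw.integrable]
      refine Finset.sum_eq_zero fun i _ => ?_
      rw [(hlaw i).integral_eq, integral_id_gaussianReal]
    · congr 1
      have := IndepFun.variance_sum (μ := P) (s := Finset.range n)
        (X := fun (i : ℕ) ω => Real.exp (c * τ (i + 1)) * (W (τ (i + 1)) ω - W (τ i) ω))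
        (fun i _ => (hlaw i).hasGaussianLaw.memLp_two)
        (fun i _ j _ hij => hind'.indepFun hij)
      simp_rw [hvar] at this
      rw [← this]
      congr 1
      ext ω
      rw [Finset.sum_apply, Finset.sum_range]

theorem hasLaw_expWiener [IsProbabilityMeasure P] (hW : IsBrownianReal W P) {c : ℝ} (hc : c ≠ 0)
    (t : ℝ≥0) :
    HasLaw (fun ω => expWiener c (W · ω) t)
      (gaussianReal 0 ((Real.exp (2 * c * t) - 1) / (2 * c)).toNNReal) P := by
  refine hasLaw_gaussianReal_of_tendsto (fun n => hasLaw_expWienerSum hW.toIsPreBrownianReal c t n)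
    (by filter_upwards [hW.cont] with ω hω using tendsto_expWienerSum c hω t) ?_
  have h := tendsto_sum_mul_sub_integral (g := fun s => Real.exp (2 * c * s))
    (F := fun s => s) (F' := fun _ => 1) (by fun_prop) hasDerivAt_id' continuous_const t.coe_nonneg
    (fun n i => t * (i + 1 : ℕ) / n) (fun n i => ⟨by push_cast; gcongr; linarith, le_rfl⟩)
  have hI : ∫ s in (0 : ℝ)..t, Real.exp (2 * c * s) * 1 = (Real.exp (2 * c * t) - 1) / (2 * c) := by
    have h2c : 2 * c ≠ 0 := by simpa using hc
    simp_rw [mul_one]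
    rw [intervalIntegral.integral_comp_mul_left (fun x => Real.exp x) h2c, integral_exp]
    simp [div_eq_inv_mul]
  rw [hI] at h
  refine (((NNReal.continuous_coe.comp continuous_real_toNNReal).tendsto _).comp h).congr
    fun n => ?_
  simp only [Function.comp_apply]
  push_cast
  rfl

theorem measurable_expWienerSum (c : ℝ) (t : ℝ≥0) (n : ℕ) : Measurable (expWienerSum c t n) := by
  unfold expWienerSum
  fun_prop

theorem indepFun_expWiener_shift [IsProbabilityMeasure P] (hW : IsBrownianReal W P) (c : ℝ)
    (t₀ t : ℝ≥0) :
    IndepFun (fun ω => expWiener c (fun s => W (t₀ + s) ω - W t₀ ω) t)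
      (fun ω => expWiener c (W · ω) t₀) P := by
  have hpre := hW.toIsPreBrownianReal
  refine indepFun_of_tendsto (fun n => (hasLaw_expWienerSum (hpre.shift t₀) c t n).aemeasurable)
    (fun n => (hasLaw_expWienerSum hpre c t₀ n).aemeasurable)
    (by filter_upwards [(hW.shift t₀).cont] with ω hω using tendsto_expWienerSum c hω t)
    (by filter_upwards [hW.cont] with ω hω using tendsto_expWienerSum c hω t₀) fun n => ?_
  -- The past is given only on `Set.Iic t₀`, so the path is extended by freezing it at `t₀`. The sum
  -- never looks beyond `t₀`, so this leaves it unchanged.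
  have h := (hpre.indepFun_shift t₀).comp (measurable_expWienerSum c t n)
    (ψ := fun w : Set.Iic t₀ → ℝ =>
      expWienerSum c t₀ n fun s => w ⟨min s t₀, Set.mem_Iic.2 (min_le_right _ _)⟩)
    ((measurable_expWienerSum c t₀ n).comp (by fun_prop))
  suffices hpast : (fun ω => expWienerSum c t₀ n (W · ω)) =
      (fun w : Set.Iic t₀ → ℝ => expWienerSum c t₀ n
        fun s => w ⟨min s t₀, Set.mem_Iic.2 (min_le_right _ _)⟩) ∘
        fun ω (s : Set.Iic t₀) => W s ω by
    rw [hpast]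
    exact h
  funext ω
  simp only [Function.comp_apply, expWienerSum]
  apply Finset.sum_congr rfl
  intro i hi
  have hn : (0 : ℝ≥0) < n := by exact_mod_cast (Nat.zero_le i).trans_lt (Finset.mem_range.1 hi)
  have h1 : t₀ * (i + 1 : ℕ) / n ≤ t₀ := by
    rw [div_le_iff₀ hn]
    gcongr
    exact_mod_cast Finset.mem_range.1 hi
  have h2 : t₀ * i / n ≤ t₀ := by
    rw [div_le_iff₀ hn]
    gcongr
    exact_mod_cast (Finset.mem_range.1 hi).le
  rw [min_eq_left h1, min_eq_left h2]

end Wiener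

/-! ### The Ornstein–Uhlenbeck process -/

/-- Variation of constants for the pathwise Ornstein–Uhlenbeck equation. -/
theorem eq_of_ou_equation {c σ y₀ : ℝ} {y w : ℝ≥0 → ℝ} (hy : Continuous y) (hw : Continuous w)
    (hw0 : w 0 = 0)
    (h : ∀ t : ℝ≥0, y t = y₀ + (∫ s in (0 : ℝ)..t, -c * y s.toNNReal) + σ * w t) (t : ℝ≥0) :
    y t = Real.exp (-c * t) * (y₀ + σ * expWiener c w t) := by
  have hyc : Continuous fun s : ℝ => y s.toNNReal := hy.comp continuous_real_toNNReal
  -- `Z` is the differentiable part of `y`, namely `y - σ w`. The integrating factor `e^{cu}` is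
  -- applied to it because `y` itself need not be differentiable.
  set Z : ℝ → ℝ := fun u => y₀ + ∫ s in (0 : ℝ)..u, -c * y s.toNNReal with hZ
  have hZd (u : ℝ) : HasDerivAt Z (-c * y u.toNNReal) u :=
    ((continuous_const.mul hyc).integral_hasStrictDerivAt 0 u).hasDerivAt.const_add y₀
  have hder : ∀ u ∈ Set.uIcc (0 : ℝ) t, HasDerivAt (fun u => Real.exp (c * u) * Z u)
      (-σ * (w u.toNNReal * (c * Real.exp (c * u)))) u := by
    intro u hu
    rw [Set.uIcc_of_le t.coe_nonneg] at hu
    have h1 := (hasDerivAt_exp_mul c u).mul (hZd u)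
    have h2 := h u.toNNReal
    rw [Real.coe_toNNReal u hu.1] at h2
    refine h1.congr_deriv ?_
    rw [h2]
    simp only [hZ]
    ring
  have hF := intervalIntegral.integral_eq_sub_of_hasDerivAt hder
    ((by fun_prop : Continuous fun u : ℝ => -σ * (w u.toNNReal * (c * Real.exp (c * u))))
      |>.intervalIntegrable _ _)
  rw [intervalIntegral.integral_const_mul] at hF
  have hZ0 : Z 0 = y₀ := by simp [hZ]
  have hZt : Z t = y t - σ * w t := by rw [h t]; simp [hZ]
  rw [hZ0, hZt, mul_zero, Real.exp_zero, one_mul] at hF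
  have he : Real.exp (-c * t) * Real.exp (c * t) = 1 := by rw [← Real.exp_add]; simp
  rw [expWiener, hw0]
  linear_combination -Real.exp (-c * t) * hF - y t * he

/-- The Wiener integral over `[0, t₀ + t]` splits at `t₀`. -/
theorem expWiener_add (c : ℝ) {w : ℝ≥0 → ℝ} (hw : Continuous w) (t₀ t : ℝ≥0) :
    expWiener c w (t₀ + t) = expWiener c w t₀ +
      Real.exp (c * t₀) * expWiener c (fun s => w (t₀ + s) - w t₀) t := by
  set f : ℝ → ℝ := fun s => w s.toNNReal * (c * Real.exp (c * s)) with hf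
  have hfc : Continuous f := by fun_prop
  have h1 : ∫ s in (0 : ℝ)..(t₀ + t : ℝ≥0), f s =
      (∫ s in (0 : ℝ)..t₀, f s) + ∫ s in (0 : ℝ)..t, f (t₀ + s) := by
    rw [intervalIntegral.integral_comp_add_left, add_zero,
      intervalIntegral.integral_add_adjacent_intervals (hfc.intervalIntegrable _ _)
        (hfc.intervalIntegrable _ _)]
    rfl
  have h2 : ∫ s in (0 : ℝ)..t, f (t₀ + s) = Real.exp (c * t₀) *
      ∫ s in (0 : ℝ)..t, w (t₀ + s.toNNReal) * (c * Real.exp (c * s)) := by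
    rw [← intervalIntegral.integral_const_mul]
    refine intervalIntegral.integral_congr fun s hs => ?_
    rw [Set.uIcc_of_le t.coe_nonneg] at hs
    simp only [hf]
    rw [Real.toNNReal_add t₀.coe_nonneg hs.1, Real.toNNReal_coe, mul_add, Real.exp_add]
    ring
  have h3 : ∫ s in (0 : ℝ)..t, (w (t₀ + s.toNNReal) - w t₀) * (c * Real.exp (c * s)) =
      (∫ s in (0 : ℝ)..t, w (t₀ + s.toNNReal) * (c * Real.exp (c * s))) -
        w t₀ * (Real.exp (c * t) - 1) := by
    have h4 : ∫ s in (0 : ℝ)..t, c * Real.exp (c * s) = Real.exp (c * t) - 1 := by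
      rw [intervalIntegral.integral_eq_sub_of_hasDerivAt (fun x _ => hasDerivAt_exp_mul c x)
        ((by fun_prop : Continuous fun s : ℝ => c * Real.exp (c * s)).intervalIntegrable _ _)]
      simp
    simp_rw [sub_mul]
    rw [intervalIntegral.integral_sub
      ((by fun_prop : Continuous fun s : ℝ => _ ).intervalIntegrable _ _)
      ((by fun_prop : Continuous fun s : ℝ => _ ).intervalIntegrable _ _),
      intervalIntegral.integral_const_mul, h4]
  simp only [expWiener]
  rw [h1, h2, h3, add_zero, sub_self, NNReal.coe_add, mul_add, Real.exp_add]
  ring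

/-! ### Transition densities and the entropy production -/

theorem continuous_gaussianPDFReal (μ : ℝ) (v : ℝ≥0) : Continuous (gaussianPDFReal μ v) := by
  rw [gaussianPDFReal_def]
  fun_prop

/-- The Gaussian density is continuous, so the fundamental theorem of calculus applies at every
point; this evaluates `transitionDensity` everywhere, not just almost everywhere. -/
theorem hasDerivAt_cdf_gaussianReal (μ : ℝ) {v : ℝ≥0} (hv : v ≠ 0) (x : ℝ) :
    HasDerivAt (fun z => cdf (gaussianReal μ v) z) (gaussianPDFReal μ v x) x := by
  have hint := integrable_gaussianPDFReal μ v
  have h : (fun z => cdf (gaussianReal μ v) z) = fun z =>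
      (∫ y in Set.Iic (0 : ℝ), gaussianPDFReal μ v y) + ∫ y in (0 : ℝ)..z, gaussianPDFReal μ v y := by
    funext z
    rw [← intervalIntegral.integral_Iic_sub_Iic hint.integrableOn hint.integrableOn, cdf_eq_real,
      Measure.real, gaussianReal_apply_eq_integral μ hv, ENNReal.toReal_ofReal]
    · ring
    · exact setIntegral_nonneg measurableSet_Iic fun y _ => gaussianPDFReal_nonneg μ v y
  rw [h]
  exact ((continuous_gaussianPDFReal μ v).integral_hasStrictDerivAt 0 x).hasDerivAt.const_add _

section OU

variable {Ω : Type*} [MeasurableSpace Ω] {P : Measure Ω} {κ θ y₀ : ℝ} {W Y : ℝ≥0 → Ω → ℝ}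

theorem IsOUProcess.ae_eq (hY : IsOUProcess κ θ y₀ W Y P) (hW : IsBrownianReal W P) :
    ∀ᵐ ω ∂P, ∀ t, Y t ω =
      Real.exp (-(κ * θ) * t) * (y₀ + √(2 * κ) * expWiener (κ * θ) (W · ω) t) := by
  filter_upwards [hY.cont, hY.eqn, hW.cont, hW.eval_zero_ae_eq_zero] with ω h1 h2 h3 h4 t
  refine eq_of_ou_equation (y := (Y · ω)) (w := (W · ω)) h1 h3 h4 (fun t => ?_) t
  rw [h2 t]
  congr 3
  funext s
  ring

theorem IsOUProcess.hasLaw [IsProbabilityMeasure P] (hκ : 0 < κ) (hθ : 0 < θ)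
    (hY : IsOUProcess κ θ y₀ W Y P) (hW : IsBrownianReal W P) (t : ℝ≥0) :
    HasLaw (Y t) (gaussianReal (Real.exp (-(κ * θ) * t) * y₀)
      ((1 - Real.exp (-(κ * θ) * t) ^ 2) / θ).toNNReal) P := by
  have hc : 0 < κ * θ := mul_pos hκ hθ
  have h1 := hasLaw_expWiener hW hc.ne' t
  have h2 := gaussianReal_const_add
    (gaussianReal_const_mul h1 (Real.exp (-(κ * θ) * t) * √(2 * κ)))
    (Real.exp (-(κ * θ) * t) * y₀)
  have h3 : HasLaw (Y t) _ P := h2.congr (by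
    filter_upwards [hY.ae_eq hW] with ω hω
    rw [hω t]
    ring)
  convert! h3 using 2
  · ring
  · apply NNReal.eq
    have he : Real.exp (-(κ * θ) * t) ≤ 1 := Real.exp_le_one_iff.2 (by
      have := t.coe_nonneg
      nlinarith [mul_nonneg hc.le this])
    have he' : 1 ≤ Real.exp (2 * (κ * θ) * t) := Real.one_le_exp (by positivity)
    have hprod : Real.exp (2 * (κ * θ) * t) = (Real.exp (-(κ * θ) * t) ^ 2)⁻¹ := by
      rw [← Real.exp_nat_mul, ← Real.exp_neg]
      congr 1
      push_cast
      ring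
    have hpos := Real.exp_pos (-(κ * θ) * t)
    rw [NNReal.coe_mul, Real.coe_toNNReal _ (div_nonneg (by nlinarith) hθ.le), Real.coe_toNNReal _
      (div_nonneg (by linarith) (by positivity)), NNReal.coe_mk, hprod, mul_pow,
      Real.sq_sqrt (by positivity)]
    field_simp

theorem transitionDensity_eq_gaussianPDFReal [IsProbabilityMeasure P] (hκ : 0 < κ) (hθ : 0 < θ)
    {Y : ℝ → ℝ≥0 → Ω → ℝ} (hY : ∀ x, IsOUProcess κ θ x W (Y x) P) (hW : IsBrownianReal W P)
    {t : ℝ≥0} (ht : 0 < t) (x y : ℝ) :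
    transitionDensity Y P t x y = gaussianPDFReal (Real.exp (-(κ * θ) * t) * x)
      ((1 - Real.exp (-(κ * θ) * t) ^ 2) / θ).toNNReal y := by
  rw [transitionDensity, ((hY x).hasLaw hκ hθ hW t).map_eq]
  refine (hasDerivAt_cdf_gaussianReal _ ?_ y).deriv
  have he : Real.exp (-(κ * θ) * t) < 1 := Real.exp_lt_one_iff.2 (by
    have : (0 : ℝ) < t := ht
    have := mul_pos (mul_pos hκ hθ) this
    linarith)
  have hpos := Real.exp_pos (-(κ * θ) * t)
  exact (Real.toNNReal_pos.2 (div_pos (by nlinarith) hθ)).ne'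

end OU

theorem log_gaussianPDFReal (μ : ℝ) {v : ℝ} (hv : 0 < v) (x : ℝ) :
    Real.log (gaussianPDFReal μ v.toNNReal x) =
      -(Real.log (2 * Real.pi) + Real.log v) / 2 - (x - μ) ^ 2 / (2 * v) := by
  rw [gaussianPDFReal, Real.coe_toNNReal _ hv.le, Real.log_mul (by positivity) (by positivity),
    Real.log_exp, Real.log_inv, Real.log_sqrt (by positivity),
    Real.log_mul (by positivity) (by positivity)]
  ring

/-- Since `(y - r x)² - (x - r y)² = (1 - r²)(y² - x²)`, the forward and backward transitions
contribute only `θ/2 (x² - y²)`, with no mixed term. The logarithm comes from the normalizations of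
the two marginals. -/
theorem log_transition_ratio {θ e₁ e₂ r : ℝ} (hθ : 0 < θ) (he₁ : 0 < e₁) (he₁' : e₁ < 1)
    (hr : 0 < r) (hr' : r < 1) (he₂ : e₂ = e₁ * r) (x y : ℝ) :
    Real.log ((gaussianPDFReal (e₁ * 0) ((1 - e₁ ^ 2) / θ).toNNReal x *
        gaussianPDFReal (r * x) ((1 - r ^ 2) / θ).toNNReal y) /
      (gaussianPDFReal (e₂ * 0) ((1 - e₂ ^ 2) / θ).toNNReal y *
        gaussianPDFReal (r * y) ((1 - r ^ 2) / θ).toNNReal x)) =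
      1 / 2 * Real.log ((1 - e₂ ^ 2) / (1 - e₁ ^ 2)) +
        θ / 2 * (-(e₁ ^ 2 / (1 - e₁ ^ 2) * x ^ 2) + e₂ ^ 2 / (1 - e₂ ^ 2) * y ^ 2) := by
  have he₂p : 0 < e₂ := he₂ ▸ mul_pos he₁ hr
  have he₂1 : e₂ < 1 := by rw [he₂]; nlinarith
  have h1 : 0 < 1 - e₁ ^ 2 := by nlinarith
  have h2 : 0 < 1 - e₂ ^ 2 := by nlinarith
  have h3 : 0 < 1 - r ^ 2 := by nlinarith
  have pos {v : ℝ} (hv : 0 < v) (μ x : ℝ) : gaussianPDFReal μ (v / θ).toNNReal x ≠ 0 :=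
    (gaussianPDFReal_pos _ _ _ (Real.toNNReal_pos.2 (div_pos hv hθ)).ne').ne'
  rw [Real.log_div (mul_ne_zero (pos h1 _ _) (pos h3 _ _)) (mul_ne_zero (pos h2 _ _) (pos h3 _ _)),
    Real.log_mul (pos h1 _ _) (pos h3 _ _), Real.log_mul (pos h2 _ _) (pos h3 _ _),
    log_gaussianPDFReal _ (div_pos h1 hθ), log_gaussianPDFReal _ (div_pos h2 hθ),
    log_gaussianPDFReal _ (div_pos h3 hθ), log_gaussianPDFReal _ (div_pos h3 hθ),
    Real.log_div h1.ne' hθ.ne', Real.log_div h2.ne' hθ.ne', Real.log_div h2.ne' h1.ne']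
  field_simp
  ring

/-! ### Diagonalization of a Gaussian quadratic form -/

/-- Trace and determinant force the eigenvalues `w₁` and `-w₂`. The unit eigenvector `(c, s)` for
`w₁` has `c² = (A + w₂)/(w₁ + w₂)`, `s² = (C + w₂)/(w₁ + w₂)` and `c s = B/(w₁ + w₂)`; as `B ≥ 0`,
both entries can be nonnegative roots. -/
theorem exists_rotation_of_det_neg {A B C w₁ w₂ : ℝ} (hB : 0 ≤ B) (hw₁ : 0 < w₁) (hw₂ : 0 < w₂)
    (htr : w₁ - w₂ = A + C) (hdet : -(w₁ * w₂) = A * C - B ^ 2) :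
    ∃ c s : ℝ, c ^ 2 + s ^ 2 = 1 ∧ ∀ x y : ℝ,
      A * x ^ 2 + 2 * B * x * y + C * y ^ 2 =
        w₁ * (c * x + s * y) ^ 2 - w₂ * (-s * x + c * y) ^ 2 := by
  have hw : 0 < w₁ + w₂ := add_pos hw₁ hw₂
  have hprod : (A + w₂) * (C + w₂) = B ^ 2 := by linear_combination (-w₂) * htr - hdet
  have hsum : (A + w₂) + (C + w₂) = w₁ + w₂ := by linear_combination -htr
  have hA : 0 ≤ A + w₂ := by
    by_contra h
    nlinarith [sq_nonneg B]
  have hC : 0 ≤ C + w₂ := by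
    by_contra h
    nlinarith [sq_nonneg B]
  have hc := Real.sq_sqrt (div_nonneg hA hw.le)
  have hs := Real.sq_sqrt (div_nonneg hC hw.le)
  have hcs : √((A + w₂) / (w₁ + w₂)) * √((C + w₂) / (w₁ + w₂)) = B / (w₁ + w₂) := by
    rw [← Real.sqrt_mul (div_nonneg hA hw.le), div_mul_div_comm, hprod, ← sq, ← div_pow,
      Real.sqrt_sq (div_nonneg hB hw.le)]
  set c := √((A + w₂) / (w₁ + w₂))
  set s := √((C + w₂) / (w₁ + w₂))
  rw [eq_div_iff hw.ne'] at hc hs hcs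
  have h1 : c ^ 2 + s ^ 2 = 1 := mul_right_cancel₀ hw.ne' (by linear_combination hc + hs + hsum)
  refine ⟨c, s, h1, fun x y => ?_⟩
  linear_combination  -x ^ 2 * hc - y ^ 2 * hs - 2 * x * y * hcs +
    w₂ * (x ^ 2 + y ^ 2) * h1

section Rotation

variable {Ω : Type*} [MeasurableSpace Ω] {P : Measure Ω}

/-- The rotated pair is jointly Gaussian with covariance `-cs + sc = 0`, hence independent. -/
theorem indepFun_rotation [IsProbabilityMeasure P] {X Y : Ω → ℝ} (hX : HasLaw X (gaussianReal 0 1) P)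
    (hY : HasLaw Y (gaussianReal 0 1) P) (h : IndepFun X Y P) {c s : ℝ} (hcs : c ^ 2 + s ^ 2 = 1) :
    HasLaw (fun ω => c * X ω + s * Y ω) (gaussianReal 0 1) P ∧
      HasLaw (fun ω => -s * X ω + c * Y ω) (gaussianReal 0 1) P ∧
      IndepFun (fun ω => c * X ω + s * Y ω) (fun ω => -s * X ω + c * Y ω) P := by
  have hlaw (c s : ℝ) (hcs : c ^ 2 + s ^ 2 = 1) :
      HasLaw (fun ω => c * X ω + s * Y ω) (gaussianReal 0 1) P := by
    refine ⟨(hX.aemeasurable.const_mul c).add (hY.aemeasurable.const_mul s), ?_⟩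
    have := gaussianReal_add_gaussianReal_of_indepFun
      (h.comp (measurable_const_mul c) (measurable_const_mul s))
      (gaussianReal_const_mul hX c).map_eq (gaussianReal_const_mul hY s).map_eq
    refine this.trans ?_
    congr 1
    · simp
    · apply NNReal.eq
      push_cast
      simpa using hcs
  refine ⟨hlaw c s hcs, hlaw (-s) c (by linarith), ?_⟩
  have hG : HasGaussianLaw (fun ω => (X ω, Y ω)) P := h.hasGaussianLaw hX.hasGaussianLaw
    hY.hasGaussianLaw
  have hG' : HasGaussianLaw (fun ω => (c * X ω + s * Y ω, -s * X ω + c * Y ω)) P :=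
    hG.map_fun ((c • ContinuousLinearMap.fst ℝ ℝ ℝ + s • ContinuousLinearMap.snd ℝ ℝ ℝ).prod
      (-s • ContinuousLinearMap.fst ℝ ℝ ℝ + c • ContinuousLinearMap.snd ℝ ℝ ℝ))
  refine hG'.indepFun_of_covariance_eq_zero ?_
  have mX := hX.hasGaussianLaw.memLp_two
  have mY := hY.hasGaussianLaw.memLp_two
  have hc0 : cov[X, Y; P] = 0 := h.covariance_eq_zero mX mY
  have vX : cov[X, X; P] = 1 := by
    rw [covariance_self hX.aemeasurable, hX.variance_eq, variance_id_gaussianReal]; simp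
  have vY : cov[Y, Y; P] = 1 := by
    rw [covariance_self hY.aemeasurable, hY.variance_eq, variance_id_gaussianReal]; simp
  change cov[(fun ω => c * X ω) + (fun ω => s * Y ω),
    (fun ω => -s * X ω) + (fun ω => c * Y ω); P] = 0
  rw [covariance_add_left (mX.const_mul c) (mY.const_mul s)
      ((mX.const_mul (-s)).add (mY.const_mul c)),
    covariance_add_right (mX.const_mul c) (mX.const_mul _) (mY.const_mul _),
    covariance_add_right (mY.const_mul s) (mX.const_mul _) (mY.const_mul _)]
  simp only [covariance_const_mul_left, covariance_const_mul_right]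
  rw [covariance_comm Y X, hc0, vX, vY]
  ring

end Rotation

/-! ### The entropy production as a quadratic form in two normals -/

section EntropyProduction

variable {Ω : Type*} [MeasurableSpace Ω] {P : Measure Ω} {κ θ : ℝ} {W : ℝ≥0 → Ω → ℝ}

/-- Two positions of the Ornstein–Uhlenbeck process started at `0` in terms of two independent
standard normal variables. -/
theorem exists_normals_of_ou [IsProbabilityMeasure P] (hκ : 0 < κ) (hθ : 0 < θ)
    (hW : IsBrownianReal W P) {Y : ℝ≥0 → Ω → ℝ} (hY : IsOUProcess κ θ 0 W Y P)
    {t τ : ℝ≥0} (ht : 0 < t) (hτ : 0 < τ) {e r : ℝ} (he : e = Real.exp (-(κ * θ) * t))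
    (hr : r = Real.exp (-(κ * θ) * τ)) :
    ∃ G₁ G₂ : Ω → ℝ, HasLaw G₁ (gaussianReal 0 1) P ∧ HasLaw G₂ (gaussianReal 0 1) P ∧
      IndepFun G₁ G₂ P ∧ ∀ᵐ ω ∂P, Y t ω = √((1 - e ^ 2) / θ) * G₁ ω ∧
        Y (t + τ) ω = r * (√((1 - e ^ 2) / θ) * G₁ ω) + √((1 - r ^ 2) / θ) * G₂ ω := by
  have hc : 0 < κ * θ := mul_pos hκ hθ
  have hind := (indepFun_expWiener_shift hW (κ * θ) t τ).symm
  have law₁ := hasLaw_expWiener hW hc.ne' t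
  have law₂ := hasLaw_expWiener (hW.shift t) hc.ne' τ
  set I₁ : Ω → ℝ := fun ω => expWiener (κ * θ) (W · ω) t
  set I₂ : Ω → ℝ := fun ω => expWiener (κ * θ) (fun s => W (t + s) ω - W t ω) τ
  -- The Wiener integral has positive variance, and after normalizing it to variance one the noise
  -- amplitude `e^{-cu} √(2κ)` becomes the standard deviation of the process at time `u`.
  have aux {u : ℝ≥0} (hu : 0 < u) {ε : ℝ} (hε : ε = Real.exp (-(κ * θ) * u)) :
      0 < (Real.exp (2 * (κ * θ) * u) - 1) / (2 * (κ * θ)) ∧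
      ε * √(2 * κ) = √((1 - ε ^ 2) / θ) *
        (√((Real.exp (2 * (κ * θ) * u) - 1) / (2 * (κ * θ))))⁻¹ := by
    have h1 : 1 < Real.exp (2 * (κ * θ) * u) := Real.one_lt_exp_iff.2 (by positivity)
    have h2 : 0 < (Real.exp (2 * (κ * θ) * u) - 1) / (2 * (κ * θ)) :=
      div_pos (by linarith) (by positivity)
    refine ⟨h2, ?_⟩
    have hεp : 0 < ε := hε ▸ Real.exp_pos _
    have hprod : Real.exp (2 * (κ * θ) * u) = (ε ^ 2)⁻¹ := by
      rw [hε, ← Real.exp_nat_mul, ← Real.exp_neg]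
      congr 1
      push_cast
      ring
    rw [eq_mul_inv_iff_mul_eq₀ (Real.sqrt_pos.2 h2).ne', mul_assoc,
      ← Real.sqrt_mul (by positivity), ← Real.sqrt_sq hεp.le, ← Real.sqrt_mul (by positivity),
      Real.sqrt_sq hεp.le]
    congr 1
    rw [hprod]
    field_simp
  have std {I : Ω → ℝ} {v : ℝ} (hv : 0 < v) (hI : HasLaw I (gaussianReal 0 v.toNNReal) P) :
      HasLaw (fun ω => (√v)⁻¹ * I ω) (gaussianReal 0 1) P := by
    have := gaussianReal_const_mul hI (√v)⁻¹
    convert this using 2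
    · simp
    · apply NNReal.eq
      rw [NNReal.coe_mul, Real.coe_toNNReal _ hv.le, NNReal.coe_mk, inv_pow, Real.sq_sqrt hv.le]
      simp [hv.ne']
  obtain ⟨hv₁, hs₁⟩ := aux ht he
  obtain ⟨hv₂, hs₂⟩ := aux hτ hr
  refine ⟨_, _, std hv₁ law₁, std hv₂ law₂,
    hind.comp (measurable_const_mul _) (measurable_const_mul _), ?_⟩
  filter_upwards [hY.ae_eq hW, hW.cont] with ω hω hcont
  have hadd := expWiener_add (κ * θ) hcont t τ
  have he' : Real.exp (-(κ * θ) * (t + τ : ℝ≥0)) = e * r := by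
    rw [he, hr, ← Real.exp_add]
    push_cast
    ring_nf
  have hee : e * Real.exp (κ * θ * t) = 1 := by rw [he, ← Real.exp_add]; simp
  constructor
  · rw [hω t, ← he, ← mul_assoc, ← hs₁]
    ring
  · rw [hω (t + τ), hadd, he', ← mul_assoc √((1 - e ^ 2) / θ), ← mul_assoc √((1 - r ^ 2) / θ),
      ← hs₁, ← hs₂]
    linear_combination r * √(2 * κ) * I₂ ω * hee

/-- The entropy production as a weighted difference of squares of independent normal variables. -/
theorem exists_normals_entropyProduction [IsProbabilityMeasure P] (hκ : 0 < κ) (hθ : 0 < θ)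
    {t₁ t₂ : ℝ≥0} (ht₁ : 0 < t₁) (ht₂ : t₁ < t₂) (hW : IsBrownianReal W P)
    {Y : ℝ → ℝ≥0 → Ω → ℝ} (hY : ∀ x, IsOUProcess κ θ x W (Y x) P) {q₁ q₂ w₁ w₂ : ℝ}
    (hq₁ : q₁ = Real.exp (-2 * κ * θ * t₁)) (hq₂ : q₂ = Real.exp (-2 * κ * θ * t₂))
    (hw₁ : 0 < w₁) (hw₂ : 0 < w₂) (htr : w₁ - w₂ = (q₂ - q₁) / 2)
    (hdet : w₁ * w₂ = q₂ * (q₁ - q₂) / (4 * (1 - q₂))) :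
    ∃ H₁ H₂ : Ω → ℝ, HasLaw H₁ (gaussianReal 0 1) P ∧ HasLaw H₂ (gaussianReal 0 1) P ∧
      IndepFun H₁ H₂ P ∧ ∀ᵐ ω ∂P,
        entropyProduction (transitionDensity Y P) 0 t₁ t₂ (Y 0 t₁ ω) (Y 0 t₂ ω) =
          1 / 2 * Real.log ((1 - q₂) / (1 - q₁)) + w₁ * H₁ ω ^ 2 - w₂ * H₂ ω ^ 2 := by
  obtain ⟨τ, rfl⟩ := le_iff_exists_add.1 ht₂.le
  have hτ : 0 < τ := by simpa using ht₂
  have hc : 0 < κ * θ := mul_pos hκ hθ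
  obtain ⟨e, he⟩ : ∃ e, e = Real.exp (-(κ * θ) * t₁) := ⟨_, rfl⟩
  obtain ⟨r, hr⟩ : ∃ r, r = Real.exp (-(κ * θ) * τ) := ⟨_, rfl⟩
  have he0 : 0 < e := he ▸ Real.exp_pos _
  have hr0 : 0 < r := hr ▸ Real.exp_pos _
  have he1 : e < 1 := he ▸ Real.exp_lt_one_iff.2 (by nlinarith)
  have hr1 : r < 1 := hr ▸ Real.exp_lt_one_iff.2 (by nlinarith)
  have her : Real.exp (-(κ * θ) * (t₁ + τ : ℝ≥0)) = e * r := by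
    rw [he, hr, ← Real.exp_add]
    push_cast
    ring_nf
  have hq₁' : q₁ = e ^ 2 := by
    rw [hq₁, he, ← Real.exp_nat_mul]
    push_cast
    ring_nf
  have hq₂' : q₂ = (e * r) ^ 2 := by
    rw [hq₂, ← her, ← Real.exp_nat_mul]
    push_cast
    ring_nf
  have h1 : 0 < 1 - e ^ 2 := by nlinarith
  have h3 : 0 < 1 - r ^ 2 := by nlinarith
  have h2 : 0 < 1 - (e * r) ^ 2 := by nlinarith [mul_pos he0 hr0, mul_pos he0 (sub_pos.2 hr1)]
  obtain ⟨G₁, G₂, law₁, law₂, hind, hG⟩ := exists_normals_of_ou hκ hθ hW (hY 0) ht₁ hτ he hr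
  set α := √((1 - e ^ 2) / θ)
  set β := √((1 - r ^ 2) / θ)
  have hα : α ^ 2 = (1 - e ^ 2) / θ := Real.sq_sqrt (div_pos h1 hθ).le
  have hβ : β ^ 2 = (1 - r ^ 2) / θ := Real.sq_sqrt (div_pos h3 hθ).le
  -- `F = q₂/(1 - q₂)` is, up to `θ/2`, the coefficient of the squared final position.
  obtain ⟨F, hF⟩ : ∃ F, F = (e * r) ^ 2 / (1 - (e * r) ^ 2) := ⟨_, rfl⟩
  have hF0 : 0 ≤ F := hF ▸ by positivity
  have hF' : F * (1 - (e * r) ^ 2) = (e * r) ^ 2 := by rw [hF, div_mul_cancel₀ _ h2.ne']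
  have hα' : α ^ 2 * θ = 1 - e ^ 2 := by rw [hα]; field_simp
  have hβ' : β ^ 2 * θ = 1 - r ^ 2 := by rw [hβ]; field_simp
  -- These are the coefficients of `θ/2 (-E x² + F y²)`, `E = e²/(1 - e²)`, after substituting `x =
  -- α G₁`, `y = r α G₁ + β G₂`.
  obtain ⟨c, s, hcs, hrot⟩ := exists_rotation_of_det_neg
    (A := 1 / 2 * (-e ^ 2 + F * r ^ 2 * (1 - e ^ 2))) (B := θ / 2 * F * (r * α * β))
    (C := 1 / 2 * F * (1 - r ^ 2)) (by positivity) hw₁ hw₂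
    (by rw [htr, hq₁', hq₂']; linear_combination -hF' / 2) (by
      rw [hdet, hq₁', hq₂', show (e * r) ^ 2 * (e ^ 2 - (e * r) ^ 2) / (4 * (1 - (e * r) ^ 2)) =
          F * (e ^ 2 - (e * r) ^ 2) / 4 by rw [hF, mul_comm 4, ← div_div]; ring]
      linear_combination (F * r) ^ 2 / 4 * (β ^ 2 * θ) * hα' + (F * r) ^ 2 / 4 * (1 - e ^ 2) * hβ')
  obtain ⟨lawH₁, lawH₂, hindH⟩ := indepFun_rotation law₁ law₂ hind hcs
  refine ⟨_, _, lawH₁, lawH₂, hindH, ?_⟩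
  filter_upwards [hG] with ω hω
  have hsub : t₁ + τ - t₁ = τ := add_tsub_cancel_left _ _
  have hratio := log_transition_ratio hθ he0 he1 hr0 hr1 rfl (Y 0 t₁ ω) (Y 0 (t₁ + τ) ω)
  rw [entropyProduction, hsub]
  simp only [transitionDensity_eq_gaussianPDFReal hκ hθ hY hW ht₁,
    transitionDensity_eq_gaussianPDFReal hκ hθ hY hW hτ,
    transitionDensity_eq_gaussianPDFReal hκ hθ hY hW (add_pos ht₁ hτ)]
  rw [her, ← he, ← hr, hratio, ← hF, hq₁', hq₂', add_sub_assoc, ← hrot, hω.1, hω.2]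
  congr 1
  have hE : e ^ 2 / (1 - e ^ 2) * (1 - e ^ 2) = e ^ 2 := div_mul_cancel₀ _ h1.ne'
  generalize e ^ 2 / (1 - e ^ 2) = E at *
  linear_combination (-E + F * r ^ 2) / 2 * G₁ ω ^ 2 * hα' + F / 2 * G₂ ω ^ 2 * hβ' -
    G₁ ω ^ 2 / 2 * hE

end EntropyProduction

/-! ### The Bessel function `K₀` -/

/-- The half-angle formula reduces this to `|x/2| ≤ |sinh (x/2)|`. It gives the Gaussian majorants
for `e^{-y cosh s}`, both for integrability and in Laplace's method. -/
theorem one_add_sq_div_two_le_cosh (x : ℝ) : 1 + x ^ 2 / 2 ≤ Real.cosh x := by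
  have h1 : Real.cosh x = 1 + 2 * Real.sinh (x / 2) ^ 2 := by
    have h2 := Real.cosh_two_mul (x / 2)
    have h3 := Real.cosh_sq (x / 2)
    rw [mul_div_cancel₀ x two_ne_zero] at h2
    linarith
  have h4 : |x / 2| ≤ |Real.sinh (x / 2)| := by
    rw [Real.abs_sinh]
    exact Real.self_le_sinh_iff.2 (abs_nonneg _)
  have h5 := sq_le_sq.2 h4
  rw [h1]
  nlinarith

theorem integrable_exp_neg_mul_cosh {y : ℝ} (hy : 0 < y) :
    Integrable fun s : ℝ => Real.exp (-y * Real.cosh s) := by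
  refine (integrable_exp_neg_mul_sq (half_pos hy)).mono' (by fun_prop) (ae_of_all _ fun s => ?_)
  rw [Real.norm_eq_abs, Real.abs_exp, Real.exp_le_exp]
  nlinarith [one_add_sq_div_two_le_cosh s]

theorem besselK_zero_eq (y : ℝ) :
    besselK 0 y = ∫ s in Set.Ioi (0 : ℝ), Real.exp (-y * Real.cosh s) := by
  simp [besselK]

theorem besselK_zero_nonneg (y : ℝ) : 0 ≤ besselK 0 y := by
  rw [besselK_zero_eq]
  exact integral_nonneg fun s => (Real.exp_pos _).le

theorem lintegral_exp_neg_mul_cosh_Ioi {y : ℝ} (hy : 0 < y) :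
    ∫⁻ s in Set.Ioi (0 : ℝ), ENNReal.ofReal (Real.exp (-y * Real.cosh s)) =
      ENNReal.ofReal (besselK 0 y) := by
  rw [besselK_zero_eq, ofReal_integral_eq_lintegral_ofReal
    (integrable_exp_neg_mul_cosh hy).integrableOn (ae_of_all _ fun s => (Real.exp_pos _).le)]

theorem lintegral_exp_neg_mul_cosh {y : ℝ} (hy : 0 < y) :
    ∫⁻ s : ℝ, ENNReal.ofReal (Real.exp (-y * Real.cosh s)) =
      ENNReal.ofReal (2 * besselK 0 y) := by
  rw [besselK_zero_eq, ← integral_comp_abs (f := fun s => Real.exp (-y * Real.cosh s)),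
    ← ofReal_integral_eq_lintegral_ofReal (integrable_exp_neg_mul_cosh hy)
      (ae_of_all _ fun s => (Real.exp_pos _).le)]
  simp_rw [Real.cosh_abs]

/-! ### Hyperbolic coordinates -/

/-- Hyperbolic coordinates on the right branch of the cone `(h₂ / k₂)² < (h₁ / k₁)²`. -/
noncomputable def hyperbolicCoord (k₁ k₂ : ℝ) (p : ℝ × ℝ) : ℝ × ℝ :=
  (k₁ * (√p.1 * Real.cosh (p.2 / 2)), k₂ * (√p.1 * Real.sinh (p.2 / 2)))

/-- The derivative of `hyperbolicCoord`. -/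
noncomputable def fderivHyperbolicCoord (k₁ k₂ : ℝ) (p : ℝ × ℝ) : ℝ × ℝ →L[ℝ] ℝ × ℝ :=
  (Matrix.toLin (.finTwoProd ℝ) (.finTwoProd ℝ)
    !![k₁ * (1 / (2 * √p.1) * Real.cosh (p.2 / 2)), k₁ * (√p.1 * (Real.sinh (p.2 / 2) / 2));
      k₂ * (1 / (2 * √p.1) * Real.sinh (p.2 / 2)),
        k₂ * (√p.1 * (Real.cosh (p.2 / 2) / 2))]).toContinuousLinearMap

theorem hasFDerivAt_hyperbolicCoord (k₁ k₂ : ℝ) {p : ℝ × ℝ} (hp : 0 < p.1) :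
    HasFDerivAt (hyperbolicCoord k₁ k₂) (fderivHyperbolicCoord k₁ k₂ p) p := by
  unfold fderivHyperbolicCoord
  rw [Matrix.toLin_finTwoProd_toContinuousLinearMap]
  have hs := (Real.hasDerivAt_sqrt hp.ne').comp_hasFDerivAt p
    (hasFDerivAt_fst (𝕜 := ℝ) (E := ℝ) (F := ℝ))
  have hd : HasDerivAt (fun s : ℝ => s / 2) (1 / 2) p.2 := (hasDerivAt_id p.2).div_const 2
  have hc := (hd.cosh).comp_hasFDerivAt p (hasFDerivAt_snd (𝕜 := ℝ) (E := ℝ) (F := ℝ))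
  have hsh := (hd.sinh).comp_hasFDerivAt p (hasFDerivAt_snd (𝕜 := ℝ) (E := ℝ) (F := ℝ))
  refine (((hs.mul hc).const_mul k₁).prodMk ((hs.mul hsh).const_mul k₂)).congr_fderiv ?_
  ext <;> simp <;> ring_nf <;> simp

/-- Using the value of the form, rather than its root, as radial coordinate makes the area element
constant, by `cosh² - sinh² = 1`. The half angle makes the squares combine to `cosh s`. -/
theorem det_fderivHyperbolicCoord (k₁ k₂ : ℝ) {p : ℝ × ℝ} (hp : 0 < p.1) :
    (fderivHyperbolicCoord k₁ k₂ p).det = k₁ * k₂ / 4 := by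
  have h := Real.cosh_sq (p.2 / 2)
  unfold fderivHyperbolicCoord
  simp only [LinearMap.det_toContinuousLinearMap, LinearMap.det_toLin, Matrix.det_fin_two_of]
  field_simp
  linear_combination 4 * k₁ * k₂ * h

theorem hyperbolicCoord_sq {w₁ w₂ : ℝ} (hw₁ : 0 < w₁) (hw₂ : 0 < w₂) {p : ℝ × ℝ} (hp : 0 < p.1) :
    w₁ * (hyperbolicCoord (√w₁)⁻¹ (√w₂)⁻¹ p).1 ^ 2 = p.1 * Real.cosh (p.2 / 2) ^ 2 ∧
      w₂ * (hyperbolicCoord (√w₁)⁻¹ (√w₂)⁻¹ p).2 ^ 2 = p.1 * Real.sinh (p.2 / 2) ^ 2 := by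
  simp only [hyperbolicCoord, mul_pow, inv_pow, Real.sq_sqrt hw₁.le, Real.sq_sqrt hw₂.le,
    Real.sq_sqrt hp.le]
  constructor <;> field_simp

theorem image_hyperbolicCoord {w₁ w₂ : ℝ} (hw₁ : 0 < w₁) (hw₂ : 0 < w₂) :
    hyperbolicCoord (√w₁)⁻¹ (√w₂)⁻¹ '' (Set.Ioi 0 ×ˢ Set.univ) =
      {h | 0 < h.1 ∧ 0 < w₁ * h.1 ^ 2 - w₂ * h.2 ^ 2} := by
  ext h
  constructor
  · rintro ⟨p, ⟨hp, -⟩, rfl⟩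
    have hp : 0 < p.1 := hp
    obtain ⟨h1, h2⟩ := hyperbolicCoord_sq hw₁ hw₂ hp
    refine ⟨?_, ?_⟩
    · have := Real.cosh_pos (p.2 / 2)
      simp only [hyperbolicCoord]
      positivity
    · rw [h1, h2, Real.cosh_sq]
      linarith
  · rintro ⟨h1, h2⟩
    obtain ⟨x, hx⟩ : ∃ x, x = w₁ * h.1 ^ 2 - w₂ * h.2 ^ 2 := ⟨_, rfl⟩
    rw [← hx] at h2
    -- The first coordinate is the value of the form; the angle is solved from the `sinh` component.
    refine ⟨(x, 2 * Real.arsinh (√w₂ * h.2 / √x)), ⟨h2, trivial⟩, ?_⟩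
    have hsinh : Real.sinh (2 * Real.arsinh (√w₂ * h.2 / √x) / 2) = √w₂ * h.2 / √x := by
      rw [mul_div_cancel_left₀ _ two_ne_zero, Real.sinh_arsinh]
    have hcosh : Real.cosh (2 * Real.arsinh (√w₂ * h.2 / √x) / 2) = √w₁ * h.1 / √x := by
      have h0 := Real.cosh_pos (2 * Real.arsinh (√w₂ * h.2 / √x) / 2)
      rw [← Real.sqrt_sq h0.le, Real.cosh_sq, hsinh, ← Real.sqrt_sq (by positivity :
        0 ≤ √w₁ * h.1 / √x), div_pow, div_pow, mul_pow, mul_pow, Real.sq_sqrt hw₁.le,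
        Real.sq_sqrt hw₂.le, Real.sq_sqrt h2.le]
      congr 1
      field_simp
      linarith
    ext
    · simp only [hyperbolicCoord, hcosh]
      field_simp
    · simp only [hyperbolicCoord, hsinh]
      field_simp

theorem injOn_hyperbolicCoord {w₁ w₂ : ℝ} (hw₁ : 0 < w₁) (hw₂ : 0 < w₂) :
    Set.InjOn (hyperbolicCoord (√w₁)⁻¹ (√w₂)⁻¹) (Set.Ioi 0 ×ˢ Set.univ) := by
  rintro p ⟨hp, -⟩ p' ⟨hp', -⟩ h
  have hp : 0 < p.1 := hp
  have hp' : 0 < p'.1 := hp'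
  obtain ⟨h1, h2⟩ := hyperbolicCoord_sq hw₁ hw₂ hp
  obtain ⟨h1', h2'⟩ := hyperbolicCoord_sq hw₁ hw₂ hp'
  rw [h] at h1 h2
  have hx : p.1 = p'.1 := by
    have := Real.cosh_sq (p.2 / 2)
    have := Real.cosh_sq (p'.2 / 2)
    nlinarith
  have h3 := congrArg Prod.snd h
  simp only [hyperbolicCoord, hx] at h3
  have hs2 := (inv_pos.2 (Real.sqrt_pos.2 hw₂)).ne'
  have h4 := Real.sinh_injective
    (mul_left_cancel₀ (Real.sqrt_pos.2 hp').ne' (mul_left_cancel₀ hs2 h3))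
  exact Prod.ext hx (by linarith)

theorem setLIntegral_cone_eq {w₁ w₂ : ℝ} (hw₁ : 0 < w₁) (hw₂ : 0 < w₂)
    {G : ℝ × ℝ → ENNReal} (hG : Measurable G) :
    ∫⁻ h in {h : ℝ × ℝ | 0 < h.1 ∧ 0 < w₁ * h.1 ^ 2 - w₂ * h.2 ^ 2}, G h =
      ENNReal.ofReal ((√w₁)⁻¹ * (√w₂)⁻¹ / 4) *
        ∫⁻ x in Set.Ioi (0 : ℝ), ∫⁻ s, G (hyperbolicCoord (√w₁)⁻¹ (√w₂)⁻¹ (x, s)) := by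
  have hm : MeasurableSet (Set.Ioi (0 : ℝ) ×ˢ (Set.univ : Set ℝ)) :=
    measurableSet_Ioi.prod MeasurableSet.univ
  have hmeas : Measurable (hyperbolicCoord (√w₁)⁻¹ (√w₂)⁻¹) := by
    unfold hyperbolicCoord
    fun_prop
  rw [← image_hyperbolicCoord hw₁ hw₂, lintegral_image_eq_lintegral_abs_det_fderiv_mul volume hm
    (fun p hp => (hasFDerivAt_hyperbolicCoord _ _ hp.1).hasFDerivWithinAt)
    (injOn_hyperbolicCoord hw₁ hw₂)]
  have h1 : ∫⁻ p in Set.Ioi (0 : ℝ) ×ˢ (Set.univ : Set ℝ),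
      ENNReal.ofReal |(fderivHyperbolicCoord (√w₁)⁻¹ (√w₂)⁻¹ p).det| *
        G (hyperbolicCoord (√w₁)⁻¹ (√w₂)⁻¹ p) =
      ∫⁻ p in Set.Ioi (0 : ℝ) ×ˢ (Set.univ : Set ℝ),
        ENNReal.ofReal ((√w₁)⁻¹ * (√w₂)⁻¹ / 4) * G (hyperbolicCoord (√w₁)⁻¹ (√w₂)⁻¹ p) := by
    refine setLIntegral_congr_fun hm fun p hp => ?_
    rw [det_fderivHyperbolicCoord _ _ hp.1, abs_of_nonneg (by positivity)]
  have hGm : Measurable fun p => G (hyperbolicCoord (√w₁)⁻¹ (√w₂)⁻¹ p) := hG.comp hmeas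
  rw [h1, lintegral_const_mul _ hGm, Measure.volume_eq_prod, ← Measure.prod_restrict,
    Measure.restrict_univ, lintegral_prod _ hGm.aemeasurable]

/-! ### The density of a weighted difference of chi-squared variables -/

/-- The density `π⁻¹ √(b² - a²) e^{ax} K₀(b|x|)`. -/
noncomputable def besselDensity (a b x : ℝ) : ℝ :=
  Real.pi⁻¹ * √(b ^ 2 - a ^ 2) * Real.exp (a * x) * besselK 0 (b * |x|)

theorem besselDensity_nonneg (a b x : ℝ) : 0 ≤ besselDensity a b x := by
  have := besselK_zero_nonneg (b * |x|)
  have := Real.pi_pos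
  unfold besselDensity
  positivity

theorem besselDensity_neg (a b x : ℝ) : besselDensity (-a) b (-x) = besselDensity a b x := by
  simp [besselDensity]

theorem measurable_besselK_zero : Measurable (besselK 0) := by
  have h : StronglyMeasurable fun p : ℝ × ℝ => Real.exp (-p.1 * Real.cosh p.2) := by
    have : Continuous fun p : ℝ × ℝ => Real.exp (-p.1 * Real.cosh p.2) := by fun_prop
    exact this.stronglyMeasurable
  have h' := (h.integral_prod_right' (ν := volume.restrict (Set.Ioi 0))).measurable
  rwa [show (besselK 0) = _ from funext besselK_zero_eq]

theorem measurable_besselDensity (a b : ℝ) : Measurable (besselDensity a b) := by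
  have := measurable_besselK_zero
  unfold besselDensity
  fun_prop

theorem gaussianReal_prod_gaussianReal :
    (gaussianReal 0 1).prod (gaussianReal 0 1) = (volume : Measure (ℝ × ℝ)).withDensity
      fun h => ENNReal.ofReal ((2 * Real.pi)⁻¹ * Real.exp (-(h.1 ^ 2 + h.2 ^ 2) / 2)) := by
  rw [gaussianReal_of_var_ne_zero 0 one_ne_zero, prod_withDensity (measurable_gaussianPDF 0 1)
    (measurable_gaussianPDF 0 1), ← Measure.volume_eq_prod]
  congr 1
  funext h
  rw [gaussianPDF, gaussianPDF, ← ENNReal.ofReal_mul (gaussianPDFReal_nonneg _ _ _)]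
  congr 1
  simp only [gaussianPDFReal, NNReal.coe_one, mul_one, sub_zero]
  rw [mul_mul_mul_comm, ← mul_inv, Real.mul_self_sqrt (by positivity), ← Real.exp_add]
  ring_nf

/-- On the positive half-line, a weighted difference of squares of independent standard normal
variables has density `besselDensity`. -/
theorem lintegral_indicator_Ioi_quadratic {a b : ℝ} (hab : |a| < b) {F : ℝ → ENNReal}
    (hF : Measurable F) :
    ∫⁻ h, (Set.Ioi 0).indicator F (1 / (2 * (b - a)) * h.1 ^ 2 - 1 / (2 * (b + a)) * h.2 ^ 2)
      ∂((gaussianReal 0 1).prod (gaussianReal 0 1)) =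
    ∫⁻ x in Set.Ioi 0, F x * ENNReal.ofReal (besselDensity a b x) := by
  obtain ⟨ha₁, ha₂⟩ := abs_lt.1 hab
  have hb : 0 < b := by linarith
  have hm : 0 < b + a := by linarith
  obtain ⟨w₁, hw₁⟩ : ∃ w, w = 1 / (2 * (b - a)) := ⟨_, rfl⟩
  obtain ⟨w₂, hw₂⟩ : ∃ w, w = 1 / (2 * (b + a)) := ⟨_, rfl⟩
  have hw₁0 : 0 < w₁ := hw₁ ▸ by positivity
  have hw₂0 : 0 < w₂ := hw₂ ▸ by positivity
  rw [← hw₁, ← hw₂]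
  set φ : ℝ × ℝ → ENNReal := fun h =>
    ENNReal.ofReal ((2 * Real.pi)⁻¹ * Real.exp (-(h.1 ^ 2 + h.2 ^ 2) / 2)) with hφ
  have hφm : Measurable φ := by fun_prop
  set Q : ℝ × ℝ → ℝ := fun h => w₁ * h.1 ^ 2 - w₂ * h.2 ^ 2 with hQ
  have hQm : Measurable Q := by fun_prop
  set G : ℝ × ℝ → ENNReal := fun h => φ h * F (Q h) with hG
  have hGm : Measurable G := hφm.mul (hF.comp hQm)
  have hT : MeasurableSet {h : ℝ × ℝ | h.1 < 0 ∧ 0 < Q h} :=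
    (measurableSet_lt measurable_fst measurable_const).inter
      (measurableSet_lt measurable_const hQm)
  have hsplit : {h : ℝ × ℝ | 0 < Q h} =
      {h : ℝ × ℝ | 0 < h.1 ∧ 0 < Q h} ∪ {h : ℝ × ℝ | h.1 < 0 ∧ 0 < Q h} := by
    ext h
    constructor
    · intro h0
      rcases lt_trichotomy h.1 0 with h1 | h1 | h1
      · exact Or.inr ⟨h1, h0⟩
      · have h0 : 0 < w₁ * h.1 ^ 2 - w₂ * h.2 ^ 2 := h0
        rw [h1] at h0
        nlinarith [mul_nonneg hw₂0.le (sq_nonneg h.2)]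
      · exact Or.inl ⟨h1, h0⟩
    · rintro (h0 | h0) <;> exact h0.2
  -- The reflection `h ↦ -h` exchanges the two branches of the cone and preserves both the form and
  -- the Gaussian weight, so one branch is counted twice.
  have hneg : ∫⁻ h in {h : ℝ × ℝ | h.1 < 0 ∧ 0 < Q h}, G h =
      ∫⁻ h in {h : ℝ × ℝ | 0 < h.1 ∧ 0 < Q h}, G h := by
    rw [← (Measure.measurePreserving_neg (volume : Measure (ℝ × ℝ))).setLIntegral_comp_preimage
      hT hGm]
    have hpre : Neg.neg ⁻¹' {h : ℝ × ℝ | h.1 < 0 ∧ 0 < Q h} =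
        {h : ℝ × ℝ | 0 < h.1 ∧ 0 < Q h} := by
      ext h
      simp [hQ]
    rw [hpre]
    simp [hG, hφ, hQ]
  rw [gaussianReal_prod_gaussianReal]
  change ∫⁻ h, ((Set.Ioi 0).indicator F ∘ Q) h ∂(volume.withDensity φ) = _
  rw [lintegral_withDensity_eq_lintegral_mul _ hφm ((hF.indicator measurableSet_Ioi).comp hQm)]
  have h1 : ∀ h, (φ * ((Set.Ioi 0).indicator F ∘ Q)) h =
      {h : ℝ × ℝ | 0 < Q h}.indicator G h := by
    intro h
    by_cases h0 : 0 < Q h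
    · simp [h0, hG]
    · simp [h0, hG]
  rw [lintegral_congr h1, lintegral_indicator (measurableSet_lt measurable_const hQm), hsplit,
    lintegral_union hT (by
      rw [Set.disjoint_left]
      rintro h ⟨h0, -⟩ ⟨h0', -⟩
      exact lt_asymm h0 h0'), hneg, ← two_mul, setLIntegral_cone_eq hw₁0 hw₂0 hGm]
  -- On the hyperbola `Q = x` the Gaussian exponent `(h₁² + h₂²)/2` equals `(b - a) x cosh²(s/2) +
  -- (b + a) x sinh²(s/2) = b x cosh s - a x`.
  have hinner : ∀ x ∈ Set.Ioi (0 : ℝ), ∫⁻ s, G (hyperbolicCoord (√w₁)⁻¹ (√w₂)⁻¹ (x, s)) =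
      F x * ENNReal.ofReal (Real.pi⁻¹ * Real.exp (a * x) * besselK 0 (b * |x|)) := by
    intro x hx
    have hx : 0 < x := hx
    have h2 (s : ℝ) : G (hyperbolicCoord (√w₁)⁻¹ (√w₂)⁻¹ (x, s)) =
        F x * ENNReal.ofReal ((2 * Real.pi)⁻¹ * Real.exp (a * x)) *
          ENNReal.ofReal (Real.exp (-(b * x) * Real.cosh s)) := by
      obtain ⟨h3, h4⟩ := hyperbolicCoord_sq hw₁0 hw₂0 (p := (x, s)) hx
      have h5 := Real.cosh_sq (s / 2)
      have h6 := Real.cosh_two_mul (s / 2)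
      rw [mul_div_cancel₀ s two_ne_zero] at h6
      have hQx : Q (hyperbolicCoord (√w₁)⁻¹ (√w₂)⁻¹ (x, s)) = x := by
        simp only [hQ]
        rw [h3, h4, h5]
        ring
      simp only [hG, hφ]
      rw [hQx, mul_comm, mul_assoc, ← ENNReal.ofReal_mul (by positivity)]
      congr 2
      rw [mul_assoc, ← Real.exp_add]
      congr 2
      generalize hyperbolicCoord (√w₁)⁻¹ (√w₂)⁻¹ (x, s) = h at h3 h4 ⊢
      rw [hw₁, one_div_mul_eq_div, div_eq_iff (by positivity)] at h3
      rw [hw₂, one_div_mul_eq_div, div_eq_iff (by positivity)] at h4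
      rw [h3, h4, h6, h5]
      ring
    simp_rw [h2]
    rw [lintegral_const_mul _ (by fun_prop), lintegral_exp_neg_mul_cosh (mul_pos hb hx), mul_assoc,
      ← ENNReal.ofReal_mul (by positivity), abs_of_pos hx]
    congr 2
    field_simp
  rw [setLIntegral_congr_fun measurableSet_Ioi hinner, ← mul_assoc, ← lintegral_const_mul]
  · refine lintegral_congr fun x => ?_
    rw [mul_left_comm, show (2 : ENNReal) = ENNReal.ofReal 2 by simp,
      ← ENNReal.ofReal_mul (by positivity), ← ENNReal.ofReal_mul (by positivity)]
    congr 2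
    -- Two branches and the Jacobian together give `2 · 2√(b² - a²)/4 = √(b² - a²)`.
    have h7 : (√w₁)⁻¹ * (√w₂)⁻¹ = 2 * √(b ^ 2 - a ^ 2) := by
      rw [← mul_inv, ← Real.sqrt_mul hw₁0.le, ← Real.sqrt_inv, hw₁, hw₂,
        show (1 / (2 * (b - a)) * (1 / (2 * (b + a))))⁻¹ = 2 ^ 2 * (b ^ 2 - a ^ 2) by
          field_simp; ring, Real.sqrt_mul (by positivity), Real.sqrt_sq (by positivity)]
    rw [h7, besselDensity]
    ring
  · have := measurable_besselK_zero
    fun_prop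

section Law

variable {Ω : Type*} [MeasurableSpace Ω] {P : Measure Ω}

/-- Negative values reduce to positive ones: swapping the two normals negates the form and replaces
`a` by `-a`. The value `0` has probability zero, because each section of the zero set has at most
two points. -/
theorem hasLaw_quadratic [IsProbabilityMeasure P] {a b : ℝ} (hab : |a| < b) {H₁ H₂ : Ω → ℝ}
    (h₁ : HasLaw H₁ (gaussianReal 0 1) P) (h₂ : HasLaw H₂ (gaussianReal 0 1) P)
    (hind : IndepFun H₁ H₂ P) :
    HasLaw (fun ω => 1 / (2 * (b - a)) * H₁ ω ^ 2 - 1 / (2 * (b + a)) * H₂ ω ^ 2)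
      (volume.withDensity fun x => ENNReal.ofReal (besselDensity a b x)) P := by
  obtain ⟨ha₁, ha₂⟩ := abs_lt.1 hab
  have hm : 0 < b + a := by linarith
  set γ := gaussianReal 0 1
  set X : ℝ × ℝ → ℝ := fun h => 1 / (2 * (b - a)) * h.1 ^ 2 - 1 / (2 * (b + a)) * h.2 ^ 2 with hX
  have hXm : Measurable X := by fun_prop
  have hlaw : HasLaw (fun ω => (H₁ ω, H₂ ω)) (γ.prod γ) P :=
    (indepFun_iff_hasLaw_prodMk_prod h₁ h₂).1 hind
  have hdm := (measurable_besselDensity a b).ennreal_ofReal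
  suffices HasLaw X (volume.withDensity fun x => ENNReal.ofReal (besselDensity a b x))
    (γ.prod γ) from this.comp hlaw
  refine ⟨hXm.aemeasurable, ?_⟩
  have hpos {s : Set ℝ} (hs : MeasurableSet s) : (γ.prod γ) (X ⁻¹' (s ∩ Set.Ioi 0)) =
      volume.withDensity (fun x => ENNReal.ofReal (besselDensity a b x)) (s ∩ Set.Ioi 0) := by
    have h := lintegral_indicator_Ioi_quadratic hab (measurable_one.indicator hs)
    rw [withDensity_apply _ (hs.inter measurableSet_Ioi), ← Measure.restrict_restrict hs,
      ← lintegral_indicator hs, ← lintegral_indicator_one (hXm (hs.inter measurableSet_Ioi))]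
    refine Eq.trans (lintegral_congr fun h => ?_) (h.trans (lintegral_congr fun x => ?_))
    · rw [Set.indicator_indicator, Set.inter_comm]
      rfl
    · by_cases hx : x ∈ s <;> simp [hx]
  have hneg {s : Set ℝ} (hs : MeasurableSet s) : (γ.prod γ) (X ⁻¹' (s ∩ Set.Iio 0)) =
      volume.withDensity (fun x => ENNReal.ofReal (besselDensity a b x)) (s ∩ Set.Iio 0) := by
    have h := lintegral_indicator_Ioi_quadratic (a := -a) (b := b) (by rwa [abs_neg])
      (measurable_one.indicator (measurable_neg hs))
    rw [withDensity_apply _ (hs.inter measurableSet_Iio), ← Measure.restrict_restrict hs,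
      ← lintegral_indicator hs, ← lintegral_indicator_one (hXm (hs.inter measurableSet_Iio)),
      ← (Measure.measurePreserving_swap (μ := γ) (ν := γ)).lintegral_comp
        (measurable_one.indicator (hXm (hs.inter measurableSet_Iio))),
      ← (Measure.measurePreserving_neg (volume : Measure ℝ)).setLIntegral_comp_preimage
        measurableSet_Iio (hdm.indicator hs)]
    have hpre : Neg.neg ⁻¹' Set.Iio (0 : ℝ) = Set.Ioi 0 := by ext; simp
    rw [hpre]
    refine Eq.trans (lintegral_congr fun h => ?_) (h.trans (lintegral_congr fun x => ?_))
    · rw [Set.indicator_indicator]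
      have hu : X h.swap = -(1 / (2 * (b - -a)) * h.1 ^ 2 - 1 / (2 * (b + -a)) * h.2 ^ 2) := by
        simp only [hX, Prod.fst_swap, Prod.snd_swap, sub_neg_eq_add, ← sub_eq_add_neg]
        ring
      generalize 1 / (2 * (b - -a)) * h.1 ^ 2 - 1 / (2 * (b + -a)) * h.2 ^ 2 = u at hu ⊢
      have hmem : h.swap ∈ X ⁻¹' (s ∩ Set.Iio 0) ↔ u ∈ Set.Ioi 0 ∩ Neg.neg ⁻¹' s := by
        simp [hu, and_comm]
      by_cases hmu : u ∈ Set.Ioi 0 ∩ Neg.neg ⁻¹' s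
      · rw [Set.indicator_of_mem hmu, Set.indicator_of_mem (hmem.2 hmu)]
        rfl
      · rw [Set.indicator_of_notMem hmu, Set.indicator_of_notMem (hmem.not.2 hmu)]
    · by_cases hx : -x ∈ s
      · simp [hx, ← besselDensity_neg a b (-x)]
      · simp [hx]
  have hzero : (γ.prod γ) (X ⁻¹' {0}) = 0 := by
    rw [Measure.measure_prod_null (hXm (measurableSet_singleton 0))]
    refine ae_of_all _ fun x => ?_
    have : NullSingletonClass γ := nullSingletonClass_gaussianReal one_ne_zero
    refine Set.Finite.measure_zero (Set.Finite.subset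
      ((Set.finite_singleton (√((b + a) / (b - a)) * |x|)).insert (-(√((b + a) / (b - a)) * |x|)))
      fun y hy => ?_) _
    have hy : 1 / (2 * (b - a)) * x ^ 2 - 1 / (2 * (b + a)) * y ^ 2 = 0 := hy
    have hy2 : y ^ 2 = (√((b + a) / (b - a)) * |x|) ^ 2 := by
      rw [mul_pow, Real.sq_sqrt (by positivity), sq_abs]
      field_simp at hy ⊢
      linarith
    rcases sq_eq_sq_iff_eq_or_eq_neg.1 hy2 with h | h
    · exact Or.inr h
    · exact Or.inl h
  ext s hs
  rw [Measure.map_apply hXm hs]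
  have hsp : s = (s ∩ Set.Ioi 0) ∪ ((s ∩ Set.Iio 0) ∪ (s ∩ {0})) := by
    ext x
    rcases lt_trichotomy x 0 with h | rfl | h
    · simp [h, h.not_gt, h.ne]
    · simp
    · simp [h, h.not_gt, h.ne']
  have hd1 : Disjoint (s ∩ Set.Ioi 0) ((s ∩ Set.Iio 0) ∪ (s ∩ {0})) := by
    rw [Set.disjoint_left]
    rintro x ⟨-, h⟩ (⟨-, h'⟩ | ⟨-, h'⟩)
    · exact lt_asymm (Set.mem_Ioi.1 h) (Set.mem_Iio.1 h')
    · exact (Set.mem_Ioi.1 h).ne' h'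
  have hd2 : Disjoint (s ∩ Set.Iio 0) (s ∩ {0}) := by
    rw [Set.disjoint_left]
    rintro x ⟨-, h⟩ ⟨-, h'⟩
    exact (Set.mem_Iio.1 h).ne h'
  have hs0 : MeasurableSet (s ∩ {0}) := hs.inter (measurableSet_singleton 0)
  have hs1 : MeasurableSet (s ∩ Set.Iio 0) := hs.inter measurableSet_Iio
  rw [hsp, Set.preimage_union, Set.preimage_union,
    measure_union (hd1.preimage X |>.mono_right (by rw [Set.preimage_union]))
      ((hXm hs1).union (hXm hs0)),
    measure_union (hd2.preimage X) (hXm hs0), measure_union hd1 (hs1.union hs0),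
    measure_union hd2 hs0, hpos hs, hneg hs,
    measure_mono_null (Set.preimage_mono Set.inter_subset_right) hzero,
    measure_mono_null Set.inter_subset_right
      (withDensity_absolutelyContinuous volume _ Real.volume_singleton)]

end Law

/-! ### Asymptotics of `K₀` -/

/-- The integrand stays near `1` until `e^s` reaches `1/y` and then collapses, so the integral is
cut at `T = -log y`. -/
theorem besselK_zero_bounds {y : ℝ} (hy : 0 < y) (hy1 : y ≤ 1) :
    -Real.log y - 1 ≤ besselK 0 y ∧ besselK 0 y ≤ -Real.log y + 2 := by
  obtain ⟨T, hT⟩ : ∃ T, T = -Real.log y := ⟨_, rfl⟩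
  have hT0 : 0 ≤ T := by rw [hT]; linarith [Real.log_nonpos hy.le hy1]
  have heT : y * Real.exp T = 1 := by
    rw [hT, Real.exp_neg, Real.exp_log hy, mul_inv_cancel₀ hy.ne']
  have hint := integrable_exp_neg_mul_cosh hy
  rw [← hT, besselK_zero_eq, ← Set.Ioc_union_Ioi_eq_Ioi hT0, setIntegral_union
    (Set.Ioc_disjoint_Ioi le_rfl) measurableSet_Ioi hint.integrableOn hint.integrableOn,
    ← intervalIntegral.integral_of_le hT0]
  have htail0 : 0 ≤ ∫ s in Set.Ioi T, Real.exp (-y * Real.cosh s) :=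
    integral_nonneg fun s => (Real.exp_pos _).le
  constructor
  · have h1 : ∫ s in (0 : ℝ)..T, (1 - y * Real.exp s) ≤
        ∫ s in (0 : ℝ)..T, Real.exp (-y * Real.cosh s) := by
      refine intervalIntegral.integral_mono_on hT0
        ((by fun_prop : Continuous fun s : ℝ => 1 - y * Real.exp s).intervalIntegrable _ _)
        hint.intervalIntegrable fun s hs => ?_
      have h2 : Real.cosh s ≤ Real.exp s := by
        rw [Real.cosh_eq]
        have := Real.exp_le_exp.2 (by linarith [hs.1] : -s ≤ s)
        linarith
      have h3 := Real.add_one_le_exp (-y * Real.cosh s)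
      nlinarith
    have h4 : ∫ s in (0 : ℝ)..T, (1 - y * Real.exp s) = T - y * (Real.exp T - 1) := by
      rw [intervalIntegral.integral_sub (by simp)
        ((by fun_prop : Continuous fun s : ℝ => y * Real.exp s).intervalIntegrable _ _),
        intervalIntegral.integral_const_mul, integral_exp]
      simp
    linarith
  · have h1 : ∫ s in (0 : ℝ)..T, Real.exp (-y * Real.cosh s) ≤ ∫ s in (0 : ℝ)..T, (1 : ℝ) := by
      refine intervalIntegral.integral_mono_on hT0 hint.intervalIntegrable (by simp) fun s _ => ?_
      exact Real.exp_le_one_iff.2 (by nlinarith [Real.cosh_pos s])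
    -- Beyond `T`, `y cosh s ≥ e^{s-T}/2 ≥ (s - T)/2`, and the resulting exponential tail integrates
    -- to `2`.
    have h2 : ∫ s in Set.Ioi T, Real.exp (-y * Real.cosh s) ≤
        ∫ s in Set.Ioi T, Real.exp (T / 2) * Real.exp (-(1 / 2) * s) := by
      refine setIntegral_mono_on hint.integrableOn
        ((integrableOn_exp_mul_Ioi (by norm_num) T).const_mul _) measurableSet_Ioi fun s _ => ?_
      rw [← Real.exp_add, Real.exp_le_exp]
      have h3 : y * Real.exp s = Real.exp (s - T) := by
        rw [Real.exp_sub, eq_div_iff (Real.exp_pos T).ne']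
        linear_combination Real.exp s * heT
      have h4 := Real.add_one_le_exp (s - T)
      have h5 := Real.exp_pos (-s)
      rw [Real.cosh_eq]
      nlinarith [mul_pos hy h5]
    have h6 : ∫ s in Set.Ioi T, Real.exp (T / 2) * Real.exp (-(1 / 2) * s) = 2 := by
      rw [integral_const_mul, integral_exp_mul_Ioi (by norm_num) T]
      have : Real.exp (T / 2) * Real.exp (-(1 / 2) * T) = 1 := by
        rw [← Real.exp_add, Real.exp_eq_one_iff]
        ring
      linear_combination 2 * this
    simp only [intervalIntegral.integral_const, sub_zero, smul_eq_mul, mul_one] at h1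
    linarith

theorem besselK_zero_isEquivalent_log {b : ℝ} (hb : 0 < b) :
    (fun u : ℝ => besselK 0 (b * |u|)) ~[𝓝[≠] 0] fun u => -Real.log |u| := by
  have hO : (fun u : ℝ => besselK 0 (b * |u|) - -Real.log |u|) =O[𝓝[≠] 0] fun _ => (1 : ℝ) := by
    refine IsBigO.of_bound (2 + |Real.log b|) ?_
    have h1 : ∀ᶠ u : ℝ in 𝓝[≠] 0, b * |u| < 1 := by
      refine nhdsWithin_le_nhds ?_
      have hc : Continuous fun u : ℝ => b * |u| := by fun_prop
      exact hc.continuousAt.eventually_lt continuousAt_const (by simp)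
    filter_upwards [h1, self_mem_nhdsWithin] with u hu hu0
    have hu' : 0 < |u| := abs_pos.2 hu0
    obtain ⟨h2, h3⟩ := besselK_zero_bounds (mul_pos hb hu') hu.le
    rw [Real.log_mul hb.ne' hu'.ne'] at h2 h3
    rw [Real.norm_eq_abs, norm_one, mul_one, abs_le]
    constructor <;> linarith [neg_abs_le (Real.log b), le_abs_self (Real.log b)]
  refine hO.trans_isLittleO ?_
  rw [isLittleO_const_left]
  right
  refine tendsto_norm_atTop_atTop.comp (tendsto_neg_atBot_atTop.comp ?_)
  simp_rw [Real.log_abs]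
  exact Real.tendsto_log_nhdsNE_zero

theorem tendsto_mul_cosh_sub_one (u : ℝ) :
    Tendsto (fun y : ℝ => y * (Real.cosh ((√y)⁻¹ * u) - 1)) atTop (𝓝 (u ^ 2 / 2)) := by
  have hlim : Tendsto (fun y : ℝ => u ^ 2 / 2 + (u ^ 2 / 2) ^ 2 * y⁻¹) atTop (𝓝 (u ^ 2 / 2)) := by
    have h := (tendsto_inv_atTop_zero (𝕜 := ℝ)).const_mul ((u ^ 2 / 2) ^ 2)
      |>.const_add (u ^ 2 / 2)
    rwa [mul_zero, add_zero] at h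
  refine tendsto_of_tendsto_of_tendsto_of_le_of_le' tendsto_const_nhds hlim ?_ ?_
  · filter_upwards [eventually_gt_atTop 0] with y hy
    have h := one_add_sq_div_two_le_cosh ((√y)⁻¹ * u)
    rw [mul_pow, inv_pow, Real.sq_sqrt hy.le] at h
    calc u ^ 2 / 2 = y * (y⁻¹ * u ^ 2 / 2) := by field_simp
      _ ≤ _ := by gcongr; linarith
  · filter_upwards [eventually_gt_atTop 0, eventually_ge_atTop (u ^ 2 / 2)] with y hy hyu
    have h := Real.cosh_le_exp_half_sq ((√y)⁻¹ * u)
    rw [mul_pow, inv_pow, Real.sq_sqrt hy.le] at h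
    have h1 : |y⁻¹ * u ^ 2 / 2| ≤ 1 := by
      rw [abs_of_nonneg (by positivity), mul_div_assoc, inv_mul_le_iff₀ hy]
      linarith
    have h2 := (abs_le.1 (Real.abs_exp_sub_one_sub_id_le h1)).2
    calc _ ≤ y * (y⁻¹ * u ^ 2 / 2 + (y⁻¹ * u ^ 2 / 2) ^ 2) := by gcongr; linarith
      _ = _ := by field_simp

/-- Laplace's method: substituting `t = u/√y` turns the expression into the integral of `exp(-y
(cosh(u/√y) - 1))`, which converges pointwise to `e^{-u²/2}` and is dominated by that same function.
-/
theorem tendsto_sqrt_mul_exp_mul_besselK_zero :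
    Tendsto (fun y : ℝ => √y * Real.exp y * besselK 0 y) atTop (𝓝 √(Real.pi / 2)) := by
  have hcongr : ∀ᶠ y : ℝ in atTop, ∫ u in Set.Ioi (0 : ℝ),
      Real.exp (-(y * (Real.cosh ((√y)⁻¹ * u) - 1))) = √y * Real.exp y * besselK 0 y := by
    filter_upwards [eventually_gt_atTop 0] with y hy
    have hs := Real.sqrt_pos.2 hy
    rw [integral_comp_mul_left_Ioi (fun t => Real.exp (-(y * (Real.cosh t - 1)))) 0
      (inv_pos.2 hs), mul_zero, inv_inv, smul_eq_mul, besselK_zero_eq, mul_assoc]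
    congr 1
    rw [← integral_const_mul]
    congr 1
    funext t
    rw [← Real.exp_add]
    congr 1
    ring
  refine Tendsto.congr' hcongr ?_
  have hval : ∫ u in Set.Ioi (0 : ℝ), Real.exp (-(u ^ 2 / 2)) = √(Real.pi / 2) := by
    have h := integral_gaussian_Ioi (1 / 2)
    simp_rw [show ∀ u : ℝ, -(u ^ 2 / 2) = -(1 / 2) * u ^ 2 from fun u => by ring]
    rw [h, show Real.pi / (1 / 2) = 2 ^ 2 * (Real.pi / 2) by ring, Real.sqrt_mul (by norm_num),
      Real.sqrt_sq (by norm_num), mul_div_cancel_left₀ _ two_ne_zero]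
  rw [← hval]
  have hbound : Integrable fun u : ℝ => Real.exp (-(u ^ 2 / 2)) := by
    simpa [div_eq_inv_mul] using integrable_exp_neg_mul_sq (b := 1 / 2) (by norm_num)
  refine tendsto_integral_filter_of_dominated_convergence _ (Eventually.of_forall fun y => ?_) ?_
    hbound.integrableOn (ae_of_all _ fun u => ?_)
  · exact (by fun_prop : Continuous fun u : ℝ =>
      Real.exp (-(y * (Real.cosh ((√y)⁻¹ * u) - 1)))).aestronglyMeasurable
  · filter_upwards [eventually_gt_atTop 0] with y hy
    refine ae_of_all _ fun u => ?_
    rw [Real.norm_eq_abs, Real.abs_exp, Real.exp_le_exp, neg_le_neg_iff]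
    have h := one_add_sq_div_two_le_cosh ((√y)⁻¹ * u)
    rw [mul_pow, inv_pow, Real.sq_sqrt hy.le] at h
    calc u ^ 2 / 2 = y * (y⁻¹ * u ^ 2 / 2) := by field_simp
      _ ≤ _ := by gcongr; linarith
  · exact (Real.continuous_exp.tendsto _).comp (tendsto_mul_cosh_sub_one u).neg

/-! ### Asymptotics of the density -/

theorem besselDensity_isEquivalent_log {a b : ℝ} (hab : |a| < b) (s : ℝ) :
    (fun x => besselDensity a b (x - s)) ~[𝓝[≠] s]
      fun x => Real.pi⁻¹ * √(b ^ 2 - a ^ 2) * -Real.log |x - s| := by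
  have hb : 0 < b := (abs_nonneg a).trans_lt hab
  have hexp : (fun u : ℝ => Real.pi⁻¹ * √(b ^ 2 - a ^ 2) * Real.exp (a * u)) ~[𝓝[≠] 0]
      fun _ => Real.pi⁻¹ * √(b ^ 2 - a ^ 2) := by
    have hd : 0 < b ^ 2 - a ^ 2 := sub_pos.2 (sq_lt_sq.2 (by rwa [abs_of_pos hb]))
    refine (isEquivalent_const_iff_tendsto (by have := Real.pi_pos; positivity)).2 ?_
    refine tendsto_nhdsWithin_of_tendsto_nhds ?_
    have hc : Continuous fun u : ℝ => Real.pi⁻¹ * √(b ^ 2 - a ^ 2) * Real.exp (a * u) := by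
      fun_prop
    simpa using hc.tendsto 0
  have h := hexp.mul (besselK_zero_isEquivalent_log hb)
  have hshift : Tendsto (fun x : ℝ => x - s) (𝓝[≠] s) (𝓝[≠] 0) := by
    refine tendsto_nhdsWithin_iff.2 ⟨tendsto_nhdsWithin_of_tendsto_nhds ?_, ?_⟩
    · simpa using (continuous_sub_right s).tendsto s
    · filter_upwards [self_mem_nhdsWithin] with x hx
      exact sub_ne_zero.2 hx
  exact h.comp_tendsto hshift

theorem exists_besselDensity_isEquivalent_atTop {a b : ℝ} (hab : |a| < b) (s : ℝ) :
    ∃ C : ℝ, 0 < C ∧ (fun x => besselDensity a b (x - s)) ~[atTop]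
      fun x => C * (|x| ^ (-(1 / 2) : ℝ) * Real.exp (-(b - a) * x)) := by
  have hb : 0 < b := (abs_nonneg a).trans_lt hab
  have hd : 0 < b ^ 2 - a ^ 2 := sub_pos.2 (sq_lt_sq.2 (by rwa [abs_of_pos hb]))
  -- The factor `e^{(b-a)s}` absorbs the shift in the exponential, and `(√b)⁻¹` comes from
  -- evaluating `K₀` at `b (x - s)`.
  obtain ⟨A, hA⟩ : ∃ A, A = Real.pi⁻¹ * √(b ^ 2 - a ^ 2) * Real.exp ((b - a) * s) * (√b)⁻¹ :=
    ⟨_, rfl⟩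
  have hA0 : 0 < A := by rw [hA]; positivity
  have hC0 : 0 < A * √(Real.pi / 2) := by positivity
  refine ⟨A * √(Real.pi / 2), hC0, ?_⟩
  have hu : Tendsto (fun x : ℝ => x - s) atTop atTop := tendsto_atTop_add_const_right _ _ tendsto_id
  have hratio : Tendsto (fun x : ℝ => √(1 + s * (x - s)⁻¹)) atTop (𝓝 1) := by
    have h1 := ((tendsto_inv_atTop_zero.comp hu).const_mul s).const_add 1
    rw [mul_zero, add_zero] at h1
    have h2 := (Real.continuous_sqrt.tendsto _).comp h1
    rwa [Real.sqrt_one] at h2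
  have hJ := tendsto_sqrt_mul_exp_mul_besselK_zero.comp (hu.const_mul_atTop hb)
  have hlim := (hJ.const_mul A).mul hratio
  rw [mul_one] at hlim
  have hlim' := hlim.div_const (A * √(Real.pi / 2))
  rw [div_self hC0.ne'] at hlim'
  refine isEquivalent_of_tendsto_one (hlim'.congr' ?_)
  filter_upwards [eventually_gt_atTop s, eventually_gt_atTop 0] with x hxs hx
  have hu0 : 0 < x - s := sub_pos.2 hxs
  have h1 : √(1 + s * (x - s)⁻¹) = √x / √(x - s) := by
    rw [← Real.sqrt_div hx.le]
    congr 1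
    field_simp
    ring
  have h2 : x ^ (-(1 / 2) : ℝ) = (√x)⁻¹ := by
    rw [Real.rpow_neg hx.le, Real.sqrt_eq_rpow]
  simp only [Function.comp_apply, Pi.div_apply, neg_mul]
  rw [h1, abs_of_pos hx, h2, besselDensity, abs_of_pos hu0, Real.sqrt_mul hb.le, hA]
  have h3 : Real.exp (b * (x - s)) * Real.exp ((b - a) * s) =
      Real.exp (a * (x - s)) / Real.exp (-((b - a) * x)) := by
    rw [← Real.exp_add, ← Real.exp_sub]
    congr 1
    ring
  have h4 := (Real.exp_pos (-((b - a) * x))).ne'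
  rw [eq_div_iff h4] at h3
  field_simp
  linear_combination besselK 0 (b * (x - s)) * h3

theorem exists_besselDensity_isEquivalent_atBot {a b : ℝ} (hab : |a| < b) (s : ℝ) :
    ∃ C : ℝ, 0 < C ∧ (fun x => besselDensity a b (x - s)) ~[atBot]
      fun x => C * (|x| ^ (-(1 / 2) : ℝ) * Real.exp ((b + a) * x)) := by
  obtain ⟨C, hC, h⟩ := exists_besselDensity_isEquivalent_atTop (a := -a) (by rwa [abs_neg]) (-s)
  refine ⟨C, hC, ?_⟩
  have e₁ : (fun x => besselDensity a b (x - s)) =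
      (fun x => besselDensity (-a) b (x - -s)) ∘ Neg.neg := by
    funext x
    rw [Function.comp_apply, ← besselDensity_neg]
    ring_nf
  have e₂ : (fun x => C * (|x| ^ (-(1 / 2) : ℝ) * Real.exp ((b + a) * x))) =
      (fun x => C * (|x| ^ (-(1 / 2) : ℝ) * Real.exp (-(b - -a) * x))) ∘ Neg.neg := by
    funext x
    simp only [Function.comp_apply, abs_neg]
    ring_nf
  rw [e₁, e₂]
  exact h.comp_tendsto tendsto_neg_atBot_atTop

/-! ### Half-line moments of the density -/

section HyperbolicIntegrals

variable {a b : ℝ}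

theorem tendsto_cosh_atTop : Tendsto Real.cosh atTop atTop := by
  refine tendsto_atTop_mono' _ ?_ tendsto_id
  filter_upwards with x
  have := one_add_sq_div_two_le_cosh x
  simp only [id]
  nlinarith [sq_nonneg (x - 1)]

theorem tendsto_sinh_div_cosh : Tendsto (fun t => Real.sinh t / Real.cosh t) atTop (𝓝 1) := by
  have h : Tendsto (fun t : ℝ => 1 - Real.exp (-t) * (Real.cosh t)⁻¹) atTop (𝓝 1) := by
    have h1 := Real.tendsto_exp_neg_atTop_nhds_zero.mul
      (tendsto_inv_atTop_zero.comp tendsto_cosh_atTop)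
    have h2 := h1.const_sub 1
    rwa [mul_zero, sub_zero] at h2
  refine h.congr fun t => ?_
  have := (Real.cosh_pos t).ne'
  rw [← Real.cosh_sub_sinh]
  field_simp
  ring

theorem mul_cosh_sub_pos (hab : |a| < b) (t : ℝ) : 0 < b * Real.cosh t - a := by
  obtain ⟨-, ha⟩ := abs_lt.1 hab
  have hb : 0 < b := (abs_nonneg a).trans_lt hab
  nlinarith [Real.one_le_cosh t]

theorem tendsto_inv_cosh : Tendsto (fun t => (Real.cosh t)⁻¹) atTop (𝓝 0) :=
  tendsto_inv_atTop_zero.comp tendsto_cosh_atTop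

/-- For the argument `g` of `arccos`, `1 - g² = (√(b² - a²) sinh t / (b cosh t - a))²`. At `t = 0`
one has `g = 1`, where `arccos` is not differentiable; hence `t > 0`. -/
theorem hasDerivAt_arccos_div (hab : |a| < b) {t : ℝ} (ht : 0 < t) :
    HasDerivAt (fun t => Real.arccos ((b - a * Real.cosh t) / (b * Real.cosh t - a)) /
      √(b ^ 2 - a ^ 2)) (b * Real.cosh t - a)⁻¹ t := by
  have hb : 0 < b := (abs_nonneg a).trans_lt hab
  have hD : 0 < b ^ 2 - a ^ 2 := sub_pos.2 (sq_lt_sq.2 (by rwa [abs_of_pos hb]))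
  have hd := mul_cosh_sub_pos hab t
  have hc := Real.cosh_sq t
  set d := b * Real.cosh t - a with hd_def
  set g := (b - a * Real.cosh t) / d with hg
  have hsq : 1 - g ^ 2 = (√(b ^ 2 - a ^ 2) * Real.sinh t / d) ^ 2 := by
    rw [hg, div_pow, div_pow, mul_pow, Real.sq_sqrt hD.le, eq_div_iff (by positivity), sub_mul,
      div_mul_cancel₀ _ (by positivity), hd_def]
    linear_combination (b ^ 2 - a ^ 2) * hc
  have hpos : 0 < 1 - g ^ 2 := by rw [hsq]; positivity
  have hg1 : g ≠ -1 := by rintro h; rw [h] at hpos; norm_num at hpos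
  have hg2 : g ≠ 1 := by rintro h; rw [h] at hpos; norm_num at hpos
  have hgd : HasDerivAt (fun t => (b - a * Real.cosh t) / (b * Real.cosh t - a))
      (-(b ^ 2 - a ^ 2) * Real.sinh t / d ^ 2) t := by
    have h1 := ((Real.hasDerivAt_cosh t).const_mul a).const_sub b
    have h2 := ((Real.hasDerivAt_cosh t).const_mul b).sub_const a
    refine (h1.div h2 hd.ne').congr_deriv ?_
    rw [hd_def]
    ring
  have h := ((Real.hasDerivAt_arccos hg1 hg2).comp t hgd).div_const √(b ^ 2 - a ^ 2)
  refine h.congr_deriv ?_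
  rw [hsq, Real.sqrt_sq (by positivity)]
  have hs := Real.sq_sqrt hD.le
  have hs0 := Real.sqrt_pos.2 hD
  generalize √(b ^ 2 - a ^ 2) = r at hs hs0 ⊢
  rw [← hs]
  field_simp

theorem tendsto_arccos_div (hab : |a| < b) :
    Tendsto (fun t => Real.arccos ((b - a * Real.cosh t) / (b * Real.cosh t - a)) /
      √(b ^ 2 - a ^ 2)) atTop (𝓝 (Real.arccos (-a / b) / √(b ^ 2 - a ^ 2))) := by
  have hb : 0 < b := (abs_nonneg a).trans_lt hab
  refine Tendsto.div_const ((Real.continuous_arccos.tendsto _).comp ?_) _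
  have h1 := (tendsto_inv_cosh.const_mul b).sub_const a
  have h2 := (tendsto_inv_cosh.const_mul a).const_sub b
  have h := h1.div h2 (by simpa using hb.ne')
  rw [mul_zero, mul_zero, zero_sub, sub_zero] at h
  refine h.congr fun t => ?_
  have hc := (Real.cosh_pos t).ne'
  simp only [Pi.div_apply]
  rw [← mul_div_mul_right _ _ hc, sub_mul, sub_mul, mul_assoc, mul_assoc, inv_mul_cancel₀ hc,
    mul_one, mul_one]

theorem continuous_arccos_div (hab : |a| < b) :
    Continuous fun t => Real.arccos ((b - a * Real.cosh t) / (b * Real.cosh t - a)) /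
      √(b ^ 2 - a ^ 2) := by
  have h : Continuous fun t => (b - a * Real.cosh t) / (b * Real.cosh t - a) :=
    Continuous.div (by fun_prop) (by fun_prop) fun t => (mul_cosh_sub_pos hab t).ne'
  exact (Real.continuous_arccos.comp h).div_const _

theorem lintegral_inv_mul_cosh_sub (hab : |a| < b) :
    ∫⁻ t in Set.Ioi (0 : ℝ), ENNReal.ofReal ((b * Real.cosh t - a)⁻¹) =
      ENNReal.ofReal (Real.arccos (-a / b) / √(b ^ 2 - a ^ 2)) := by
  have hnn : ∀ t ∈ Set.Ioi (0 : ℝ), 0 ≤ (b * Real.cosh t - a)⁻¹ := fun t _ =>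
    (inv_pos.2 (mul_cosh_sub_pos hab t)).le
  have hcont := (continuous_arccos_div hab).continuousWithinAt (s := Set.Ici 0) (x := 0)
  have hder : ∀ t ∈ Set.Ioi (0 : ℝ), HasDerivAt _ _ t := fun t ht => hasDerivAt_arccos_div hab ht
  rw [← ofReal_integral_eq_lintegral_ofReal
    (integrableOn_Ioi_deriv_of_nonneg hcont hder hnn (tendsto_arccos_div hab))
    ((ae_restrict_iff' measurableSet_Ioi).2 (ae_of_all _ hnn)),
    integral_Ioi_of_hasDerivAt_of_nonneg hcont hder hnn (tendsto_arccos_div hab)]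
  have hba : b - a ≠ 0 := by
    obtain ⟨-, ha⟩ := abs_lt.1 hab
    linarith
  simp [div_self hba]

/-- With `d = b cosh t - a`, the identity `b (sinh t / d)' + a/d = (b² - a²)/d²` reduces the square
to the first power. The nonnegativity is recorded so that `ENNReal.toReal` can later be evaluated.
-/
theorem lintegral_inv_mul_cosh_sub_sq (hab : |a| < b) :
    ∫⁻ t in Set.Ioi (0 : ℝ), ENNReal.ofReal ((b * Real.cosh t - a)⁻¹ ^ 2) =
      ENNReal.ofReal ((1 + a * (Real.arccos (-a / b) / √(b ^ 2 - a ^ 2))) / (b ^ 2 - a ^ 2)) ∧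
    0 ≤ (1 + a * (Real.arccos (-a / b) / √(b ^ 2 - a ^ 2))) / (b ^ 2 - a ^ 2) := by
  have hb : 0 < b := (abs_nonneg a).trans_lt hab
  have hD : 0 < b ^ 2 - a ^ 2 := sub_pos.2 (sq_lt_sq.2 (by rwa [abs_of_pos hb]))
  have hba : b - a ≠ 0 := by
    obtain ⟨-, ha⟩ := abs_lt.1 hab
    linarith
  have hnn : ∀ t ∈ Set.Ioi (0 : ℝ), 0 ≤ (b * Real.cosh t - a)⁻¹ ^ 2 := fun t _ => sq_nonneg _
  set F : ℝ → ℝ := fun t => (b * (Real.sinh t / (b * Real.cosh t - a)) +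
    a * (Real.arccos ((b - a * Real.cosh t) / (b * Real.cosh t - a)) / √(b ^ 2 - a ^ 2))) /
      (b ^ 2 - a ^ 2) with hF
  have hcont : Continuous F :=
    (((Real.continuous_sinh.div (by fun_prop) fun t => (mul_cosh_sub_pos hab t).ne').const_mul b).add
      ((continuous_arccos_div hab).const_mul a)).div_const _
  have hder : ∀ t ∈ Set.Ioi (0 : ℝ), HasDerivAt F ((b * Real.cosh t - a)⁻¹ ^ 2) t := by
    intro t ht
    have hd := mul_cosh_sub_pos hab t
    have h1 := (Real.hasDerivAt_sinh t).div (((Real.hasDerivAt_cosh t).const_mul b).sub_const a)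
      hd.ne'
    refine (((h1.const_mul b).add ((hasDerivAt_arccos_div hab ht).const_mul a)).div_const
      (b ^ 2 - a ^ 2)).congr_deriv ?_
    have hc := Real.cosh_sq t
    set d := b * Real.cosh t - a with hd_def
    field_simp
    rw [hd_def]
    linear_combination b ^ 2 * hc
  have hlim : Tendsto F atTop
      (𝓝 ((1 + a * (Real.arccos (-a / b) / √(b ^ 2 - a ^ 2))) / (b ^ 2 - a ^ 2))) := by
    refine Tendsto.div_const (Tendsto.add ?_ ((tendsto_arccos_div hab).const_mul a)) _
    have h := (tendsto_sinh_div_cosh.div ((tendsto_inv_cosh.const_mul a).const_sub b)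
      (by simpa using hb.ne')).const_mul b
    rw [mul_zero, sub_zero, mul_one_div_cancel hb.ne'] at h
    refine h.congr fun t => ?_
    have hc := (Real.cosh_pos t).ne'
    simp only [Pi.div_apply]
    rw [div_div, mul_sub, mul_left_comm, mul_inv_cancel₀ hc, mul_one, mul_comm (Real.cosh t)]
  have hint := integral_Ioi_of_hasDerivAt_of_nonneg hcont.continuousWithinAt hder hnn hlim
  have hF0 : F 0 = 0 := by simp [hF, div_self hba]
  rw [hF0, sub_zero] at hint
  rw [← ofReal_integral_eq_lintegral_ofReal
    (integrableOn_Ioi_deriv_of_nonneg hcont.continuousWithinAt hder hnn hlim)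
    ((ae_restrict_iff' measurableSet_Ioi).2 (ae_of_all _ hnn)), ← hint]
  exact ⟨rfl, setIntegral_nonneg measurableSet_Ioi hnn⟩

theorem lintegral_pow_mul_exp_neg_mul (k : ℕ) {r : ℝ} (hr : 0 < r) :
    ∫⁻ x in Set.Ioi (0 : ℝ), ENNReal.ofReal (x ^ k * Real.exp (-(r * x))) =
      ENNReal.ofReal (k.factorial * r⁻¹ ^ (k + 1)) := by
  have h : ∫ x in Set.Ioi (0 : ℝ), x ^ k * Real.exp (-(r * x)) = k.factorial * r⁻¹ ^ (k + 1) := by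
    have h := Real.integral_rpow_mul_exp_neg_mul_Ioi (a := (k : ℝ) + 1) (by positivity) hr
    rw [Real.Gamma_nat_eq_factorial, add_sub_cancel_right] at h
    simp_rw [Real.rpow_natCast] at h
    rw [h, mul_comm, one_div]
    norm_cast
  -- A non-integrable function has Bochner integral `0` by default, so a nonzero value certifies
  -- integrability.
  have hint : IntegrableOn (fun x : ℝ => x ^ k * Real.exp (-(r * x))) (Set.Ioi 0) :=
    Integrable.of_integral_ne_zero (by rw [h]; positivity)
  rw [← ofReal_integral_eq_lintegral_ofReal hint
    ((ae_restrict_iff' measurableSet_Ioi).2 (ae_of_all _ fun x hx => by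
      have : (0 : ℝ) < x := hx
      simp only [Pi.zero_apply]
      positivity)), h]

/-- Insert the integral defining `K₀`, exchange the integrals by Tonelli, and evaluate the inner one
as a Gamma integral with rate `b cosh t - a`. -/
theorem lintegral_pow_mul_besselDensity (hab : |a| < b) (k : ℕ) :
    ∫⁻ x in Set.Ioi (0 : ℝ), ENNReal.ofReal (x ^ k * besselDensity a b x) =
      ENNReal.ofReal (Real.pi⁻¹ * √(b ^ 2 - a ^ 2) * k.factorial) *
        ∫⁻ t in Set.Ioi (0 : ℝ), ENNReal.ofReal ((b * Real.cosh t - a)⁻¹ ^ (k + 1)) := by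
  have hb : 0 < b := (abs_nonneg a).trans_lt hab
  have h1 : ∀ x ∈ Set.Ioi (0 : ℝ), ENNReal.ofReal (x ^ k * besselDensity a b x) =
      ∫⁻ t in Set.Ioi (0 : ℝ), ENNReal.ofReal (Real.pi⁻¹ * √(b ^ 2 - a ^ 2)) *
        ENNReal.ofReal (x ^ k * Real.exp (-((b * Real.cosh t - a) * x))) := by
    intro x hx
    have hx : 0 < x := hx
    have h2 (t : ℝ) : ENNReal.ofReal (Real.pi⁻¹ * √(b ^ 2 - a ^ 2)) *
        ENNReal.ofReal (x ^ k * Real.exp (-((b * Real.cosh t - a) * x))) =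
        ENNReal.ofReal (x ^ k * (Real.pi⁻¹ * √(b ^ 2 - a ^ 2) * Real.exp (a * x))) *
          ENNReal.ofReal (Real.exp (-(b * x) * Real.cosh t)) := by
      rw [← ENNReal.ofReal_mul (by positivity), ← ENNReal.ofReal_mul (by positivity),
        show -((b * Real.cosh t - a) * x) = a * x + -(b * x) * Real.cosh t by ring, Real.exp_add]
      ring_nf
    simp_rw [h2]
    rw [lintegral_const_mul _ (by fun_prop), lintegral_exp_neg_mul_cosh_Ioi (mul_pos hb hx),
      ← ENNReal.ofReal_mul (by positivity), besselDensity, abs_of_pos hx]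
    ring_nf
  have h3 : ∀ t : ℝ, ∫⁻ x in Set.Ioi (0 : ℝ), ENNReal.ofReal (Real.pi⁻¹ * √(b ^ 2 - a ^ 2)) *
      ENNReal.ofReal (x ^ k * Real.exp (-((b * Real.cosh t - a) * x))) =
      ENNReal.ofReal (Real.pi⁻¹ * √(b ^ 2 - a ^ 2) * k.factorial) *
        ENNReal.ofReal ((b * Real.cosh t - a)⁻¹ ^ (k + 1)) := by
    intro t
    rw [lintegral_const_mul _ (by fun_prop),
      lintegral_pow_mul_exp_neg_mul k (mul_cosh_sub_pos hab t),
      ← ENNReal.ofReal_mul (by positivity), ← ENNReal.ofReal_mul (by positivity), mul_assoc,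
      mul_assoc, mul_assoc]
  rw [setLIntegral_congr_fun measurableSet_Ioi h1, lintegral_lintegral_swap
    (by
      refine Measurable.aemeasurable ?_
      fun_prop), lintegral_congr h3, lintegral_const_mul _ (by fun_prop)]

end HyperbolicIntegrals

section HalfLine

variable {Ω : Type*} [MeasurableSpace Ω] {P : Measure Ω} {a b : ℝ} {X : Ω → ℝ}

theorem measureReal_pos_of_hasLaw (hab : |a| < b)
    (hX : HasLaw X (volume.withDensity fun x => ENNReal.ofReal (besselDensity a b x)) P) :
    P.real {ω | 0 < X ω} = Real.arccos (-a / b) / Real.pi := by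
  have hb : 0 < b := (abs_nonneg a).trans_lt hab
  have hD : 0 < b ^ 2 - a ^ 2 := sub_pos.2 (sq_lt_sq.2 (by rwa [abs_of_pos hb]))
  have h := lintegral_pow_mul_besselDensity hab 0
  simp only [pow_zero, one_mul, zero_add, pow_one, Nat.factorial_zero, Nat.cast_one, mul_one] at h
  rw [lintegral_inv_mul_cosh_sub hab, ← ENNReal.ofReal_mul (by positivity)] at h
  rw [hX.measureReal_eq (p := fun x => 0 < x) measurableSet_Ioi]
  change (volume.withDensity _ (Set.Ioi 0)).toReal = _
  rw [withDensity_apply _ measurableSet_Ioi]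
  refine (congrArg ENNReal.toReal h).trans ?_
  rw [ENNReal.toReal_ofReal (by have := Real.arccos_nonneg (-a / b); positivity)]
  field_simp

theorem setIntegral_pos_of_hasLaw (hab : |a| < b)
    (hX : HasLaw X (volume.withDensity fun x => ENNReal.ofReal (besselDensity a b x)) P) :
    ∫ ω in {ω | 0 < X ω}, X ω ∂P = Real.pi⁻¹ * √(b ^ 2 - a ^ 2) *
      ((1 + a * (Real.arccos (-a / b) / √(b ^ 2 - a ^ 2))) / (b ^ 2 - a ^ 2)) := by
  have h := lintegral_pow_mul_besselDensity hab 1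
  simp only [pow_one, Nat.factorial_one, Nat.cast_one, mul_one, one_add_one_eq_two] at h
  obtain ⟨hI, hnn⟩ := lintegral_inv_mul_cosh_sub_sq hab
  rw [hI, ← ENNReal.ofReal_mul (by positivity)] at h
  have h1 : ∫ ω in {ω | 0 < X ω}, X ω ∂P = ∫ ω, ((Set.Ioi 0).indicator id ∘ X) ω ∂P := by
    change ∫ ω in X ⁻¹' Set.Ioi 0, X ω ∂P = _
    rw [← integral_indicator₀ (hX.aemeasurable.nullMeasurableSet_preimage measurableSet_Ioi)]
    rfl
  have hid : 0 ≤ᵐ[(volume.withDensity fun x => ENNReal.ofReal (besselDensity a b x)).restrict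
      (Set.Ioi 0)] (id : ℝ → ℝ) :=
    (ae_restrict_iff' measurableSet_Ioi).2 (ae_of_all _ fun x hx => le_of_lt (Set.mem_Ioi.1 hx))
  rw [h1, hX.integral_comp (measurable_id.indicator measurableSet_Ioi).aestronglyMeasurable,
    integral_indicator measurableSet_Ioi,
    integral_eq_lintegral_of_nonneg_ae hid measurable_id.aestronglyMeasurable,
    restrict_withDensity measurableSet_Ioi, lintegral_withDensity_eq_lintegral_mul _
      (measurable_besselDensity a b).ennreal_ofReal (by fun_prop)]
  have h2 : ∀ x ∈ Set.Ioi (0 : ℝ), ((fun x => ENNReal.ofReal (besselDensity a b x)) *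
      fun x => ENNReal.ofReal (id x)) x = ENNReal.ofReal (x * besselDensity a b x) := by
    intro x hx
    rw [Pi.mul_apply, ← ENNReal.ofReal_mul (besselDensity_nonneg a b x), mul_comm]
    rfl
  rw [setLIntegral_congr_fun measurableSet_Ioi h2, h, ENNReal.toReal_ofReal]
  exact mul_nonneg (by positivity) hnn

end HalfLine

/-! ### Moments of the chi-squared distribution -/

theorem integral_pow_four_gaussianReal : ∫ x, x ^ 4 ∂(gaussianReal 0 1) = 3 := by
  have h := iteratedDeriv_mgf_zero (X := fun x : ℝ => x) (μ := gaussianReal 0 1) (by simp) 4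
  simp only [Pi.pow_apply] at h
  rw [← h, mgf_fun_id_gaussianReal]
  -- Differentiating `p e^{t²/2}` replaces `p` by `p' + t p`, so the factors run through `1`, `t`,
  -- `1 + t²`, `3t + t³`, `3 + 6t² + t⁴`.
  have hd (p p' : ℝ → ℝ) (hp : ∀ t, HasDerivAt p (p' t) t) :
      deriv (fun t => p t * Real.exp (t ^ 2 / 2)) =
        fun t => (p' t + t * p t) * Real.exp (t ^ 2 / 2) := by
    funext t
    have h2 : HasDerivAt (fun t : ℝ => t ^ 2 / 2) t t := by
      simpa using (hasDerivAt_pow 2 t).div_const 2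
    have h3 : HasDerivAt (fun t => p t * Real.exp (t ^ 2 / 2)) _ t := (hp t).mul h2.exp
    rw [h3.deriv]
    ring
  have h0 : (fun t : ℝ => Real.exp (0 * t + (1 : ℝ≥0) * t ^ 2 / 2)) =
      fun t => 1 * Real.exp (t ^ 2 / 2) := by
    funext t
    simp
  rw [h0, iteratedDeriv_succ, iteratedDeriv_succ, iteratedDeriv_succ, iteratedDeriv_one,
    hd _ (fun _ => 0) (fun t => hasDerivAt_const t 1),
    hd _ (fun _ => 1) (fun t => by simpa using hasDerivAt_id' t),
    hd _ (fun t => 2 * t) (fun t => by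
      refine (((hasDerivAt_pow 2 t).const_add 1).congr_deriv (by simp)).congr_of_eventuallyEq
        (.of_forall fun x => by ring)),
    hd _ (fun t => 3 + 3 * t ^ 2) (fun t => by
      refine ((((hasDerivAt_id' t).const_mul 3).add (hasDerivAt_pow 3 t)).congr_deriv
        (by simp)).congr_of_eventuallyEq (.of_forall fun x => ?_)
      simp only [Pi.add_apply]
      ring)]
  simp

section ChiSquared

variable {Ω : Type*} [MeasurableSpace Ω] {P : Measure Ω} {H : Ω → ℝ}

theorem hasLaw_sq_chiSquaredOne (hH : HasLaw H (gaussianReal 0 1) P) :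
    HasLaw (fun ω => H ω ^ 2) chiSquaredOne P :=
  have h : HasLaw (fun z : ℝ => z ^ 2) chiSquaredOne (gaussianReal 0 1) := ⟨by fun_prop, rfl⟩
  h.comp hH

theorem memLp_two_sq (hH : HasLaw H (gaussianReal 0 1) P) : MemLp (fun ω => H ω ^ 2) 2 P := by
  have h4 : MemLp (fun x : ℝ => x ^ 2) 2 (gaussianReal 0 1) := by
    rw [memLp_two_iff_integrable_sq (by fun_prop)]
    refine Integrable.of_integral_ne_zero ?_
    simp_rw [← pow_mul]
    rw [integral_pow_four_gaussianReal]
    norm_num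
  rw [← hH.map_eq] at h4
  exact (memLp_map_measure_iff (by fun_prop) hH.aemeasurable).1 h4

theorem integral_sq_eq_one (hH : HasLaw H (gaussianReal 0 1) P) : ∫ ω, H ω ^ 2 ∂P = 1 := by
  have := hH.isProbabilityMeasure
  have h1 : ∫ ω, H ω ∂P = 0 := by rw [hH.integral_eq, integral_id_gaussianReal]
  have h2 := variance_of_integral_eq_zero hH.aemeasurable h1
  rw [hH.variance_eq, variance_id_gaussianReal] at h2
  simpa using h2.symm

theorem variance_sq_eq_two (hH : HasLaw H (gaussianReal 0 1) P) :
    variance (fun ω => H ω ^ 2) P = 2 := by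
  have := hH.isProbabilityMeasure
  have h4 : ∫ ω, ((fun ω => H ω ^ 2) ^ 2) ω ∂P = 3 := by
    rw [← integral_pow_four_gaussianReal, ← hH.integral_comp (by fun_prop)]
    refine integral_congr_ae (ae_of_all _ fun ω => ?_)
    simp only [Pi.pow_apply, Function.comp_apply]
    ring
  rw [variance_eq_sub (memLp_two_sq hH), h4, integral_sq_eq_one hH]
  norm_num

end ChiSquared

/-! ### The shifted law, and conditioning on the sign -/

theorem hasLaw_const_add_withDensity {Ω : Type*} [MeasurableSpace Ω] {P : Measure Ω} {X : Ω → ℝ}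
    {f : ℝ → ENNReal} (hf : Measurable f) (hX : HasLaw X (volume.withDensity f) P) (s : ℝ) :
    HasLaw (fun ω => s + X ω) (volume.withDensity fun x => f (x - s)) P := by
  have h : HasLaw (fun x : ℝ => s + x) (volume.withDensity fun x => f (x - s))
      (volume.withDensity f) := by
    refine ⟨by fun_prop, ?_⟩
    ext A hA
    have hm : Measurable fun x : ℝ => s + x := by fun_prop
    rw [Measure.map_apply hm hA, withDensity_apply _ (hm hA), withDensity_apply _ hA,
      ← (measurePreserving_add_left volume s).setLIntegral_comp_preimage hA (by fun_prop)]
    simp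
  exact h.comp hX

section SignConditioning

variable {Ω : Type*} [MeasurableSpace Ω] {P : Measure Ω} [IsProbabilityMeasure P] {a b : ℝ}
  {X Δ : Ω → ℝ} {s : ℝ}

theorem measureReal_and_integral_cond_pos (hab : |a| < b)
    (hX : HasLaw X (volume.withDensity fun x => ENNReal.ofReal (besselDensity a b x)) P)
    (hint : Integrable X P) (hΔ : ∀ᵐ ω ∂P, Δ ω = s + X ω) :
    P.real {ω | s < Δ ω} = Real.arccos (-a / b) / Real.pi ∧
      ∫ ω, Δ ω ∂(P[|{ω | s < Δ ω}]) =
        s + a / (b ^ 2 - a ^ 2) + 1 / (√(b ^ 2 - a ^ 2) * Real.arccos (-a / b)) := by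
  have hb : 0 < b := (abs_nonneg a).trans_lt hab
  have hD : 0 < b ^ 2 - a ^ 2 := sub_pos.2 (sq_lt_sq.2 (by rwa [abs_of_pos hb]))
  have hset : ({ω | s < Δ ω} : Set Ω) =ᵐ[P] {ω | 0 < X ω} := by
    filter_upwards [hΔ] with ω hω
    refine propext ?_
    change s < Δ ω ↔ 0 < X ω
    rw [hω]
    exact lt_add_iff_pos_right s
  have hpos := measureReal_pos_of_hasLaw hab hX
  have hmean := setIntegral_pos_of_hasLaw hab hX
  refine ⟨(measureReal_congr hset).trans hpos, ?_⟩
  have hacos : 0 < Real.arccos (-a / b) := by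
    rw [Real.arccos_pos, div_lt_one hb]
    linarith [(abs_lt.1 hab).1]
  have h1 : ∫ ω in {ω | 0 < X ω}, Δ ω ∂P =
      s * P.real {ω | 0 < X ω} + ∫ ω in {ω | 0 < X ω}, X ω ∂P := by
    rw [integral_congr_ae (ae_restrict_of_ae hΔ), integral_add (integrable_const s)
      hint.integrableOn, setIntegral_const, smul_eq_mul, mul_comm]
  rw [ProbabilityTheory.cond, integral_smul_measure, measure_congr hset,
    Measure.restrict_congr_set hset, h1, smul_eq_mul, ENNReal.toReal_inv]
  change (P.real {ω | 0 < X ω})⁻¹ * _ = _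
  rw [hpos, hmean]
  have hs := Real.sq_sqrt hD.le
  have hs0 := Real.sqrt_pos.2 hD
  generalize √(b ^ 2 - a ^ 2) = r at hs hs0 ⊢
  generalize Real.arccos (-a / b) = α at hacos ⊢
  rw [← hs]
  field_simp
  ring

/-- The right-hand case applied to `-Δ`, with `a` and `s` replaced by their negatives. -/
theorem measureReal_and_integral_cond_neg (hab : |a| < b)
    (hX : HasLaw (fun ω => -X ω)
      (volume.withDensity fun x => ENNReal.ofReal (besselDensity (-a) b x)) P)
    (hint : Integrable X P) (hΔ : ∀ᵐ ω ∂P, Δ ω = s + X ω) :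
    P.real {ω | Δ ω < s} = Real.arccos (a / b) / Real.pi ∧
      ∫ ω, Δ ω ∂(P[|{ω | Δ ω < s}]) =
        s + a / (b ^ 2 - a ^ 2) - 1 / (√(b ^ 2 - a ^ 2) * Real.arccos (a / b)) := by
  have h := measureReal_and_integral_cond_pos (Δ := fun ω => -Δ ω) (s := -s)
    (by rwa [abs_neg]) hX hint.neg (by filter_upwards [hΔ] with ω hω; rw [hω]; ring)
  simp only [neg_lt_neg_iff, neg_neg, neg_sq, integral_neg] at h
  refine ⟨h.1, ?_⟩
  rw [← neg_inj, h.2]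
  ring

end SignConditioning

/-! ### Positivity of the mean and the main result -/

/-- From `log x ≥ 1 - 1/x` the right side is at least `(q₁ - q₂)/(1 - q₂)`, and `0 < 1 - q₂ < 1`
makes the inequality strict. -/
theorem sub_lt_log_div {q₁ q₂ : ℝ} (h₂ : 0 < q₂) (h : q₂ < q₁) (h₁ : q₁ < 1) :
    q₁ - q₂ < Real.log ((1 - q₂) / (1 - q₁)) := by
  have h1 : 0 < 1 - q₁ := by linarith
  have h2 : 0 < 1 - q₂ := by linarith
  have h3 := Real.one_sub_inv_le_log_of_pos (div_pos h2 h1)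
  refine lt_of_lt_of_le ?_ h3
  have h4 : 1 - ((1 - q₂) / (1 - q₁))⁻¹ = (q₁ - q₂) / (1 - q₂) := by
    field_simp
    ring
  rw [h4, lt_div_iff₀ h2]
  nlinarith

theorem proposition1 {Ω : Type*} [MeasurableSpace Ω] (P : Measure Ω) [IsProbabilityMeasure P]
    (κ θ : ℝ) (hκ : 0 < κ) (hθ : 0 < θ)
    (t₁ t₂ : ℝ≥0) (ht₁ : 0 < t₁) (ht₂ : t₁ < t₂)
    -- the Brownian motion, and for every `x` the process `Y x` started at `x`
    (W : ℝ≥0 → Ω → ℝ) (hW : IsBrownianReal W P)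
    (Y : ℝ → ℝ≥0 → Ω → ℝ) (hY : ∀ x, IsOUProcess κ θ x W (Y x) P)
    -- the entropy production over `[t₁, t₂]` of the process started at `0`
    (Δs : Ω → ℝ)
    (hΔs : ∀ ω, Δs ω =
      entropyProduction (transitionDensity Y P) 0 t₁ t₂ (Y 0 t₁ ω) (Y 0 t₂ ω))
    -- the constants and the density
    (q₁ q₂ a b sstar : ℝ)
    (hq₁ : q₁ = Real.exp (-2 * κ * θ * t₁)) (hq₂ : q₂ = Real.exp (-2 * κ * θ * t₂))
    (ha : a = -((1 - q₂) / (2 * q₂)))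
    (hb : b = √((1 - q₂) / (q₂ * (q₁ - q₂)) + ((1 - q₂) / (2 * q₂)) ^ 2))
    (hsstar : sstar = 1 / 2 * Real.log ((1 - q₂) / (1 - q₁)))
    (p : ℝ → ℝ)
    (hp : ∀ x, p x = Real.pi⁻¹ * √(b ^ 2 - a ^ 2) * Real.exp (a * (x - sstar)) *
      besselK 0 (b * |x - sstar|)) :
    -- the distribution of the entropy production
    (0 ≤ |a| ∧ |a| < b ∧
      HasLaw Δs (volume.withDensity fun x => ENNReal.ofReal (p x)) P) ∧
    -- the mean
    (Integrable Δs P ∧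
      ∫ ω, Δs ω ∂P = 1 / 2 * (Real.log ((1 - q₂) / (1 - q₁)) + (q₂ - q₁)) ∧
      0 < ∫ ω, Δs ω ∂P) ∧
    -- the variance
    (MemLp Δs 2 P ∧
      variance Δs P = (q₁ - q₂) * (q₁ + q₂ - q₁ * q₂ + q₂ ^ 2) / (2 * (1 - q₂))) ∧
    -- the logarithmic singularity of the density
    (∃ c : ℝ, 0 < c ∧ p ~[𝓝[≠] sstar] fun x => c * -Real.log |x - sstar|) ∧
    -- the probabilities of lying to the right and to the left of the singularity
    (P.real {ω | sstar < Δs ω} = Real.arccos (-a / b) / Real.pi ∧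
      P.real {ω | Δs ω < sstar} = Real.arccos (a / b) / Real.pi) ∧
    -- the conditional means
    ((∫ ω, Δs ω ∂(P[|{ω | sstar < Δs ω}]) =
        sstar + a / (b ^ 2 - a ^ 2) + 1 / (√(b ^ 2 - a ^ 2) * Real.arccos (-a / b))) ∧
      (∫ ω, Δs ω ∂(P[|{ω | Δs ω < sstar}]) =
        sstar + a / (b ^ 2 - a ^ 2) - 1 / (√(b ^ 2 - a ^ 2) * Real.arccos (a / b)))) ∧
    -- the exponents: `a` and `b` in terms of them, and the tails of the density
    (∃ lm lp : ℝ, lm < 0 ∧ 0 < lp ∧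
      (∀ l : ℝ, 1 + (q₁ - q₂) * l - q₂ * (q₁ - q₂) / (1 - q₂) * l ^ 2 =
        (1 - l / lp) * (1 - l / lm)) ∧
      a = -((lp + lm) / 2) ∧ b = (lp - lm) / 2 ∧
      (∃ C : ℝ, 0 < C ∧
        p ~[atTop] fun x => C * (|x| ^ (-(1 / 2) : ℝ) * Real.exp (-lp * x))) ∧
      (∃ C : ℝ, 0 < C ∧
        p ~[atBot] fun x => C * (|x| ^ (-(1 / 2) : ℝ) * Real.exp (-lm * x)))) ∧
    -- the weighted difference of two independent chi-squared variables
    (∃ (w₁ w₂ : ℝ) (Ξ₁ Ξ₂ : Ω → ℝ), 0 < w₁ ∧ 0 < w₂ ∧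
      HasLaw Ξ₁ chiSquaredOne P ∧ HasLaw Ξ₂ chiSquaredOne P ∧ IndepFun Ξ₁ Ξ₂ P ∧
      ∀ᵐ ω ∂P, Δs ω = sstar + w₁ * Ξ₁ ω - w₂ * Ξ₂ ω) := by
  have hc : 0 < κ * θ := mul_pos hκ hθ
  have hq₁1 : q₁ < 1 := by
    rw [hq₁]
    exact Real.exp_lt_one_iff.2 (by nlinarith)
  have hq₂0 : 0 < q₂ := hq₂ ▸ Real.exp_pos _
  have hq : q₂ < q₁ := by
    rw [hq₁, hq₂]
    exact Real.exp_lt_exp.2 (by nlinarith)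
  have h2 : 0 < 1 - q₂ := by linarith
  -- `D` is `b² - a²`. The weights satisfy `w₁ - w₂ = a/D` and `w₁ w₂ = 1/(4D)`, which are matched
  -- below to the trace and determinant of the quadratic form.
  obtain ⟨D, hD⟩ : ∃ D, D = (1 - q₂) / (q₂ * (q₁ - q₂)) := ⟨_, rfl⟩
  have hD0 : 0 < D := by rw [hD]; positivity
  have hbsq : b ^ 2 = D + a ^ 2 := by
    rw [hb, ha, hD, neg_sq, Real.sq_sqrt (by positivity)]
  have hb0 : 0 ≤ b := by rw [hb]; exact Real.sqrt_nonneg _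
  have hab : |a| < b := by
    rw [← abs_of_nonneg hb0]
    exact sq_lt_sq.1 (by linarith)
  obtain ⟨ha₁, ha₂⟩ := abs_lt.1 hab
  have hm : 0 < b - a := by linarith
  have hp' : 0 < b + a := by linarith
  have haD : a / D = (q₂ - q₁) / 2 := by
    rw [ha, hD]
    field_simp
    ring
  have hprod : (b - a) * (b + a) = D := by linear_combination hbsq
  have htr : 1 / (2 * (b - a)) - 1 / (2 * (b + a)) = (q₂ - q₁) / 2 := by
    rw [← haD, ← hprod]
    field_simp
    ring
  have hdet : 1 / (2 * (b - a)) * (1 / (2 * (b + a))) = q₂ * (q₁ - q₂) / (4 * (1 - q₂)) := by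
    have h3 : 1 / (2 * (b - a)) * (1 / (2 * (b + a))) = 1 / (4 * D) := by
      rw [← hprod]
      field_simp
      ring
    rw [h3, hD]
    field_simp
  obtain ⟨H₁, H₂, law₁, law₂, hind, hH⟩ := exists_normals_entropyProduction hκ hθ ht₁ ht₂ hW hY
    hq₁ hq₂ (w₁ := 1 / (2 * (b - a))) (w₂ := 1 / (2 * (b + a))) (by positivity) (by positivity)
    htr hdet
  have lawX := hasLaw_quadratic hab law₁ law₂ hind
  -- This is the law of the negated form, with `-a`; it serves the half-line to the left of `s*`.
  have lawX' := hasLaw_quadratic (a := -a) (by rwa [abs_neg]) law₂ law₁ hind.symm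
  obtain ⟨w₁, hw₁⟩ : ∃ w, w = 1 / (2 * (b - a)) := ⟨_, rfl⟩
  obtain ⟨w₂, hw₂⟩ : ∃ w, w = 1 / (2 * (b + a)) := ⟨_, rfl⟩
  have hw₁0 : 0 < w₁ := hw₁ ▸ by positivity
  have hw₂0 : 0 < w₂ := hw₂ ▸ by positivity
  rw [sub_neg_eq_add, ← sub_eq_add_neg] at lawX'
  rw [← hw₁, ← hw₂] at lawX lawX' htr hdet
  rw [← hw₁, ← hw₂, ← hsstar] at hH
  have hΔ : ∀ᵐ ω ∂P, Δs ω = sstar + (w₁ * H₁ ω ^ 2 - w₂ * H₂ ω ^ 2) := by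
    filter_upwards [hH] with ω hω
    rw [hΔs, hω]
    ring
  have m₁ := (memLp_two_sq law₁).const_mul w₁
  have m₂ := (memLp_two_sq law₂).const_mul w₂
  have mX : MemLp (fun ω => w₁ * H₁ ω ^ 2 - w₂ * H₂ ω ^ 2) 2 P := m₁.sub m₂
  have iX := mX.integrable one_le_two
  have mΔ : MemLp Δs 2 P := ((memLp_const sstar).add mX).ae_eq
    (by filter_upwards [hΔ] with ω hω using hω.symm)
  have hmean : ∫ ω, Δs ω ∂P = 1 / 2 * (Real.log ((1 - q₂) / (1 - q₁)) + (q₂ - q₁)) := by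
    rw [integral_congr_ae hΔ, integral_add (integrable_const _) iX,
      integral_sub (m₁.integrable one_le_two) (m₂.integrable one_le_two), integral_const_mul,
      integral_const_mul, integral_sq_eq_one law₁, integral_sq_eq_one law₂, integral_const,
      probReal_univ, one_smul, hsstar, mul_one, mul_one, htr]
    ring
  have hvar : variance Δs P = (q₁ - q₂) * (q₁ + q₂ - q₁ * q₂ + q₂ ^ 2) / (2 * (1 - q₂)) := by
    have hi : IndepFun (fun ω => w₁ * H₁ ω ^ 2) (fun ω => w₂ * H₂ ω ^ 2) P :=
      hind.comp (φ := fun x => w₁ * x ^ 2) (ψ := fun x => w₂ * x ^ 2) (by fun_prop) (by fun_prop)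
    rw [variance_congr hΔ, variance_const_add mX.aestronglyMeasurable, variance_fun_sub m₁ m₂,
      hi.covariance_eq_zero m₁ m₂, variance_const_mul, variance_const_mul, variance_sq_eq_two law₁,
      variance_sq_eq_two law₂]
    -- Rewriting the variance through `w₁ - w₂` and `w₁ w₂`, both rational in `q₁`, `q₂`, removes
    -- the square root in `b`.
    have h3 : w₁ ^ 2 * 2 - 2 * 0 + w₂ ^ 2 * 2 = 2 * (w₁ - w₂) ^ 2 + 4 * (w₁ * w₂) := by ring
    rw [h3, htr, hdet]
    field_simp
    ring
  have hpeq : p = fun x => besselDensity a b (x - sstar) := funext hp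
  have lawΔ : HasLaw Δs (volume.withDensity fun x => ENNReal.ofReal (p x)) P := by
    rw [hpeq]
    exact (hasLaw_const_add_withDensity (measurable_besselDensity a b).ennreal_ofReal lawX
      sstar).congr hΔ
  have hcondp := measureReal_and_integral_cond_pos hab lawX iX hΔ
  have hcondn := measureReal_and_integral_cond_neg hab (lawX'.congr (ae_of_all _ fun ω => by
    ring)) iX hΔ
  have hDpos : 0 < b ^ 2 - a ^ 2 := by linarith
  refine ⟨⟨abs_nonneg a, hab, lawΔ⟩, ⟨mΔ.integrable one_le_two, hmean, ?_⟩, ⟨mΔ, hvar⟩,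
    ⟨Real.pi⁻¹ * √(b ^ 2 - a ^ 2), by have := Real.pi_pos; positivity, ?_⟩,
    ⟨hcondp.1, hcondn.1⟩, ⟨hcondp.2, hcondn.2⟩,
    ⟨-(b + a), b - a, by linarith, hm, fun l => ?_, by ring, by ring, ?_, ?_⟩, ?_⟩
  · rw [hmean]
    have := sub_lt_log_div hq₂0 hq hq₁1
    linarith
  · rw [hpeq]
    exact besselDensity_isEquivalent_log hab sstar
  -- The polynomial is `(1 - 2 w₁ l)(1 + 2 w₂ l)`, whose roots are `1/(2w₁) = b - a` and `-1/(2w₂) =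
  -- -(b + a)`.
  · have h3 : q₂ * (q₁ - q₂) / (1 - q₂) = 1 / D := by rw [hD, one_div_div]
    have h4 : q₁ - q₂ = -2 * a / D := by linear_combination 2 * haD
    rw [h3, h4, ← hprod]
    field_simp
    ring
  · rw [hpeq]
    exact exists_besselDensity_isEquivalent_atTop hab sstar
  · rw [hpeq, neg_neg]
    exact exists_besselDensity_isEquivalent_atBot hab sstar
  · refine ⟨w₁, w₂, fun ω => H₁ ω ^ 2, fun ω => H₂ ω ^ 2, hw₁0, hw₂0,
      hasLaw_sq_chiSquaredOne law₁, hasLaw_sq_chiSquaredOne law₂,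
      hind.comp (φ := fun x => x ^ 2) (ψ := fun x => x ^ 2) (by fun_prop) (by fun_prop), ?_⟩
    filter_upwards [hΔ] with ω hω
    rw [hω]
    ring
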